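/- Theorem 3. A Weil algebra is a finite-dimensional local commutative $\mathbb R$-algebra with unit. Manifolds are smooth ($C^\infty$), Hausdorff, second countable and non-empty, and $M^A$ denotes the set of $\mathbb R$-algebra morphisms $C^\infty(M)\to A$ ($A$-points), with the smooth structure generated by the real components $p\mapsto \ell(p(f))$, where $f\in C^\infty(M)$ and $\ell\colon A\to\mathbb R$ is linear. Let $\varphi\colon A\to B$ be a surjective morphism of Weil algebras with kernel $I$, let $M$ be a manifold of dimension $n$, and let $\hat\varphi\colon M^A\to M^B$, $\hat\varphi(p)=\varphi\circ p$. For $p\in M^A$ let $V_p$ be the space of $\mathbb R$-linear maps $D\colon C^\infty(M)\to I$ with $D(fg)=p(f)D(g)+p(g)D(f)$ for all $f,g$. We say that addition of linear maps makes $\hat\varphi$ an affine bundle if: $M^A$ and $M^B$ are smooth manifolds; $V_p$ depends only on $q=\hat\varphi(p)$, so that it may be written $V_q$; for $p\in\hat\varphi^{-1}(q)$ and $D\in V_q$ the sum $p+D$ is an $A$-point in $\hat\varphi^{-1}(q)$; for $p,p'\in\hat\varphi^{-1}(q)$ the difference $p'-p$ lies in $V_q$; and there is $r\ge 0$ such that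 every point of $M^B$ has an open neighbourhood $U$ with diffeomorphisms $\hat\varphi^{-1}(U)\cong U\times\mathbb R^r$ and $\bigsqcup_{q\in U}V_q\cong U\times\mathbb R^r$ over $U$, the second linear on each fibre and the first affine on each fibre with the second as its linear part. (The smooth structure of $\bigsqcup_q V_q$ is generated by the real components of $q(f)$ and $D(f)$, $f\in C^\infty(M)$.) If $I^2=0$, then addition of linear maps makes $\hat\varphi$ an affine bundle. If $n\geq 1$, then addition of linear maps makes $\hat\varphi$ an affine bundle if and only if $I^2=0$. -/

import Mathlib

open scoped Manifold ContDiff Topology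

noncomputable section

namespace WeilBundle

/-! ### Smooth structures generated by real functions -/

/-- A family of real functions on `X` that generates the smooth structure of `X`. -/
class SmoothGen (X : Type*) where
  gens : Set (X → ℝ)

/-- The weak topology of the generating functions. -/
abbrev SmoothGen.topology (X : Type*) [SmoothGen X] : TopologicalSpace X :=
  ⨅ h ∈ SmoothGen.gens (X := X), TopologicalSpace.induced h inferInstance

/-- Near `x`, the function `F` is a smooth function of finitely many generating functions. -/
def SmoothAt {X : Type*} [TopologicalSpace X] [SmoothGen X] (F : X → ℝ) (x : X) : Prop :=
  ∃ (k : ℕ) (h : Fin k → X → ℝ) (w : (Fin k → ℝ) → ℝ),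
    (∀ i, h i ∈ SmoothGen.gens (X := X)) ∧ ContDiff ℝ ∞ w ∧
      ∀ᶠ y in 𝓝 x, F y = w (fun i => h i y)

/-- A map is smooth on the (open) set `U` if it pulls the generating functions of the target back
to functions that are smooth at every point of `U`. -/
def SmoothMapOn {X Y : Type*} [TopologicalSpace X] [SmoothGen X] [SmoothGen Y]
    (g : X → Y) (U : Set X) : Prop :=
  ∀ x ∈ U, ∀ h ∈ SmoothGen.gens (X := Y), SmoothAt (fun y => h (g y)) x

/-- On `ℝ^d` the smooth structure is generated by the coordinates (this is the usual one). -/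
instance (d : ℕ) : SmoothGen (EuclideanSpace ℝ (Fin d)) where
  gens := Set.range fun (i : Fin d) (x : EuclideanSpace ℝ (Fin d)) => x i

/-- The product smooth structure. -/
instance {X Y : Type*} [SmoothGen X] [SmoothGen Y] : SmoothGen (X × Y) where
  gens := {F | ∃ h ∈ SmoothGen.gens (X := X), F = fun z => h z.1} ∪
    {F | ∃ h ∈ SmoothGen.gens (X := Y), F = fun z => h z.2}

/-- `e` is a diffeomorphism from its open source onto its open target. -/
def IsDiffeo {X Y : Type*} [TopologicalSpace X] [SmoothGen X] [TopologicalSpace Y] [SmoothGen Y]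
    (e : OpenPartialHomeomorph X Y) : Prop :=
  SmoothMapOn e e.source ∧ SmoothMapOn e.symm e.target

/-- `X` is a smooth manifold: Hausdorff, second countable, and locally diffeomorphic to `ℝ^d`. -/
def IsSmoothManifold (X : Type*) [TopologicalSpace X] [SmoothGen X] : Prop :=
  T2Space X ∧ SecondCountableTopology X ∧
    ∃ d : ℕ, ∀ x : X, ∃ e : OpenPartialHomeomorph X (EuclideanSpace ℝ (Fin d)),
      x ∈ e.source ∧ IsDiffeo e

/-! ### Near-points -/

section

variable (n : ℕ) (M : Type*) [TopologicalSpace M] [ChartedSpace (EuclideanSpace ℝ (Fin n)) M]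

/-- The algebra `C^∞(M)` of smooth real functions on the `n`-dimensional manifold `M`. -/
abbrev SmoothFun : Type _ := C^∞⟮𝓡 n, M; 𝓘(ℝ, ℝ), ℝ⟯

/-- The set `M^A` of `A`-points of `M`: the `ℝ`-algebra morphisms `C^∞(M) → A`. -/
def APoint (A : Type*) [CommRing A] [Algebra ℝ A] : Type _ := SmoothFun n M →ₐ[ℝ] A

variable {n M}
variable {A B : Type*} [CommRing A] [Algebra ℝ A] [CommRing B] [Algebra ℝ B]

/-- An `A`-point as a linear map. -/
def APoint.lin (p : APoint n M A) : SmoothFun n M →ₗ[ℝ] A := AlgHom.toLinearMap p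

/-- The smooth structure of `M^A` is generated by the real components `p ↦ ℓ (p f)` of the smooth
functions `f` on `M`; the linear forms `ℓ` on `A` are the linear combinations of the coordinate
forms of a basis of `A`. -/
instance : SmoothGen (APoint n M A) where
  gens := {F | ∃ (f : SmoothFun n M) (l : A →ₗ[ℝ] ℝ), F = fun p => l (p.lin f)}

instance : TopologicalSpace (APoint n M A) := SmoothGen.topology _

/-- The natural transformation `M^A → M^B`, `p ↦ φ ∘ p`. -/
def natTrans (φ : A →ₐ[ℝ] B) (p : APoint n M A) : APoint n M B := AlgHom.comp φ p

/-- The vertical tangent space of `M^A → M^B` at `p`: the derivations `D` of `C^∞(M)`, with respect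
to `p`, that take values in the kernel of `φ`. -/
def verticalSpace (φ : A →ₐ[ℝ] B) (p : APoint n M A) :
    Submodule ℝ (SmoothFun n M →ₗ[ℝ] A) where
  carrier := {D | (∀ f g, D (f * g) = p.lin f * D g + p.lin g * D f) ∧
    ∀ f, D f ∈ RingHom.ker φ}
  add_mem' := by
    rintro D D' ⟨h1, h2⟩ ⟨h1', h2'⟩
    refine ⟨fun f g => ?_, fun f => add_mem (h2 f) (h2' f)⟩
    simp only [LinearMap.add_apply, h1, h1']
    ring
  zero_mem' := ⟨fun f g => by simp, fun f => by simp⟩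
  smul_mem' := by
    rintro c D ⟨h1, h2⟩
    refine ⟨fun f g => ?_, fun f => ?_⟩
    · simp only [LinearMap.smul_apply, h1, smul_add, mul_smul_comm]
    · rw [LinearMap.smul_apply, Algebra.smul_def]
      exact Ideal.mul_mem_left _ _ (h2 f)

/-- The fibre at `q ∈ M^B` of the bundle of derivations into the kernel of `φ`: the common elements
of the vertical spaces at the points over `q`. (If the kernel has null square, then all these
vertical spaces are equal.) -/
def modelFibre (φ : A →ₐ[ℝ] B) (q : APoint n M B) : Submodule ℝ (SmoothFun n M →ₗ[ℝ] A) :=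
  ⨅ (p : APoint n M A) (_ : natTrans φ p = q), verticalSpace φ p

/-- The total space of the bundle over `M^B` of derivations into the kernel of `φ`. -/
def ModelBundle (n : ℕ) (M : Type*) [TopologicalSpace M]
    [ChartedSpace (EuclideanSpace ℝ (Fin n)) M] (φ : A →ₐ[ℝ] B) : Type _ :=
  Σ q : APoint n M B, modelFibre φ q

/-- The projection of the bundle of derivations. -/
def ModelBundle.proj (φ : A →ₐ[ℝ] B) (v : ModelBundle n M φ) : APoint n M B := v.1

/-- As for tangent bundles, the smooth structure is generated by the real components of
the base point `q` and of the derivation `D`. -/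
instance (φ : A →ₐ[ℝ] B) : SmoothGen (ModelBundle n M φ) where
  gens := {F | ∃ (f : SmoothFun n M) (l : B →ₗ[ℝ] ℝ), F = fun v => l (v.1.lin f)} ∪
    {F | ∃ (f : SmoothFun n M) (l : A →ₗ[ℝ] ℝ), F = fun v => l (v.2.1 f)}

instance (φ : A →ₐ[ℝ] B) : TopologicalSpace (ModelBundle n M φ) := SmoothGen.topology _

end

/-- The addition of linear maps makes `M^A → M^B` an affine bundle, modelled on the vector bundle of
derivations of `C^∞(M)` into the kernel of `φ`. -/
structure IsAffineBundleByAddition (n : ℕ) (M : Type*) [TopologicalSpace M]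
    [ChartedSpace (EuclideanSpace ℝ (Fin n)) M]
    {A B : Type*} [CommRing A] [Algebra ℝ A] [CommRing B] [Algebra ℝ B] (φ : A →ₐ[ℝ] B) :
    Prop where
  /-- The total space and the base are smooth manifolds. -/
  total : IsSmoothManifold (APoint n M A)
  base : IsSmoothManifold (APoint n M B)
  /-- The vertical spaces at the points of a fibre are all the same space. -/
  vertical_eq : ∀ p : APoint n M A, verticalSpace φ p = modelFibre φ (natTrans φ p)
  /-- A near-point plus a derivation from the model space is a near-point of the same fibre. -/
  add_mem : ∀ p : APoint n M A, ∀ D ∈ modelFibre φ (natTrans φ p),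
    ∃ p' : APoint n M A, natTrans φ p' = natTrans φ p ∧ p'.lin = p.lin + D
  /-- The difference of two near-points of a fibre is a derivation from the model space. -/
  sub_mem : ∀ p p' : APoint n M A, natTrans φ p = natTrans φ p' →
    p'.lin - p.lin ∈ modelFibre φ (natTrans φ p)
  /-- Around every point of the base there are a smooth local trivialization `s` of the bundle of
  derivations, linear on the fibres, and a smooth local trivialization `t` of `M^A → M^B`,
  affine on the fibres with linear part `s`. -/
  locally_trivial : ∃ r : ℕ, ∀ q : APoint n M B,
    ∃ (t : Bundle.Trivialization (EuclideanSpace ℝ (Fin r)) (natTrans (n := n) (M := M) φ))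
      (s : Bundle.Trivialization (EuclideanSpace ℝ (Fin r)) (ModelBundle.proj (n := n) (M := M) φ)),
      q ∈ t.baseSet ∧ s.baseSet = t.baseSet ∧
      IsDiffeo t.toOpenPartialHomeomorph ∧ IsDiffeo s.toOpenPartialHomeomorph ∧
      (∀ b ∈ s.baseSet, IsLinearMap ℝ
        fun D : modelFibre φ b => (s (⟨b, D⟩ : ModelBundle n M φ)).2) ∧
      ∀ p p' : APoint n M A, natTrans φ p ∈ t.baseSet →
        ∀ D : modelFibre φ (natTrans φ p), p'.lin = p.lin + D.1 →
          (t p').2 = (t p).2 + (s (⟨natTrans φ p, D⟩ : ModelBundle n M φ)).2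

end WeilBundle

end

/-! If `I² = 0`, the pointwise conditions come from one identity: for linear maps `p` and `D`, the
failure of `p + D` to be multiplicative is the failure of `D` to be a derivation over `p`, plus the
product `D f * D g`. When `D` takes values in `I`, that product lies in `I²` and vanishes. So adding
a derivation gives a point, the difference of two points of a fibre is a derivation, and changing
`p` inside its fibre does not change the Leibniz rule.

Local triviality needs coordinates on `M^A`. Every `A`-point has a base point `x` in `M`
(`APoint.exists_isBase`) and depends only on germs at `x` (`APoint.IsBase.congr`). Hadamard's lemma
and the nilpotency of the maximal ideal show that the values on local coordinates determine the
point (`LocalCoord.eq_of_coords_eq`). Conversely, Taylor's formula turns each tuple of real numbers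
in the chart plus elements of the maximal ideal into a point (`LocalCoord.pointOf`);
multiplicativity holds because the exponential of a nilpotent derivation is an algebra morphism
(`taylorSum_mul`). In these coordinates `p ↦ φ ∘ p` is `φ` applied entrywise, so a linear section of
`φ` splits off the kernel component as fibre coordinate. Derivations are differences of points and
get the same fibre coordinate, which makes one trivialization the linear part of the other.

For the converse, move one coordinate of a real point by `a ∈ I`. The difference of the two points
satisfies the Leibniz rule on the square of that coordinate only if `a² = 0`; polarization gives `I²
= 0`. Only the condition on differences is used. -/

noncomputable section

namespace WeilBundle

/-! ### Hadamard's lemma -/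

section Analysis

open MeasureTheory Set

/-- Differentiation under the integral sign over a compact interval. -/
theorem hasFDerivAt_intervalIntegral {E F : Type*} [NormedAddCommGroup E] [NormedSpace ℝ E]
    [FiniteDimensional ℝ E] [NormedAddCommGroup F] [NormedSpace ℝ F]
    {G : E × ℝ → F} (hG : ContDiff ℝ 1 G) (x₀ : E) (a b : ℝ) :
    HasFDerivAt (fun x => ∫ t in a..b, G (x, t))
      (∫ t in a..b, (fderiv ℝ G (x₀, t)).comp (ContinuousLinearMap.inl ℝ E ℝ)) x₀ := by
  have hc : Continuous fun z : E × ℝ =>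
      (fderiv ℝ G z).comp (ContinuousLinearMap.inl ℝ E ℝ) :=
    (hG.continuous_fderiv one_ne_zero).clm_comp continuous_const
  have hcomp : IsCompact (Metric.closedBall x₀ 1 ×ˢ uIcc a b) :=
    (isCompact_closedBall x₀ 1).prod isCompact_uIcc
  obtain ⟨C, hC⟩ := hcomp.exists_bound_of_continuousOn hc.continuousOn
  refine intervalIntegral.hasFDerivAt_integral_of_dominated_of_fderiv_le
    (F' := fun x t => (fderiv ℝ G (x, t)).comp (ContinuousLinearMap.inl ℝ E ℝ))
    (bound := fun _ => C) (Metric.closedBall_mem_nhds x₀ one_pos) ?_ ?_ ?_ ?_ ?_ ?_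
  · refine Filter.Eventually.of_forall fun x => ?_
    exact (hG.continuous.comp (by fun_prop : Continuous fun t : ℝ => (x, t))).aestronglyMeasurable
  · exact (hG.continuous.comp
      (by fun_prop : Continuous fun t : ℝ => (x₀, t))).intervalIntegrable _ _
  · exact (hc.comp (by fun_prop : Continuous fun t : ℝ => (x₀, t))).aestronglyMeasurable
  · refine Filter.Eventually.of_forall fun t ht x hx => hC (x, t) ⟨hx, uIoc_subset_uIcc ht⟩
  · exact intervalIntegrable_const
  · refine Filter.Eventually.of_forall fun t _ x _ => ?_
    exact ((hG.differentiable one_ne_zero) (x, t)).hasFDerivAt.comp x (hasFDerivAt_prodMk_left x t)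

/-- Induction on the order. The target `F` is quantified inside the induction because the derivative
is again such an integral, with values in `E →L[ℝ] F`. -/
theorem contDiff_intervalIntegral_nat {E : Type} [NormedAddCommGroup E] [NormedSpace ℝ E]
    [FiniteDimensional ℝ E] (a b : ℝ) (k : ℕ) :
    ∀ {F : Type} [NormedAddCommGroup F] [NormedSpace ℝ F] {G : E × ℝ → F},
      ContDiff ℝ ∞ G → ContDiff ℝ k (fun x => ∫ t in a..b, G (x, t)) := by
  induction k with
  | zero =>
    intro F _ _ G hG
    refine contDiff_zero.2 (continuous_iff_continuousAt.2 fun x => ?_)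
    exact (hasFDerivAt_intervalIntegral (hG.of_le (by simp)) x a b).continuousAt
  | succ k ih =>
    intro F _ _ G hG
    have hd := fun x => hasFDerivAt_intervalIntegral (hG.of_le (by simp)) x a b
    push_cast
    refine (contDiff_succ_iff_fderiv).2 ⟨fun x => (hd x).differentiableAt, by simp, ?_⟩
    rw [show fderiv ℝ (fun x => ∫ t in a..b, G (x, t)) = _ from funext fun x => (hd x).fderiv]
    exact ih (G := fun z => (fderiv ℝ G z).comp (ContinuousLinearMap.inl ℝ E ℝ))
      ((hG.fderiv_right (by simp)).clm_comp contDiff_const)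

/-- Hadamard's lemma. -/
theorem exists_hadamard {n : ℕ} {u : EuclideanSpace ℝ (Fin n) → ℝ} (hu : ContDiff ℝ ∞ u)
    (x : EuclideanSpace ℝ (Fin n)) :
    ∃ g : Fin n → EuclideanSpace ℝ (Fin n) → ℝ, (∀ i, ContDiff ℝ ∞ (g i)) ∧
      ∀ y, u y = u x + ∑ i, (y i - x i) * g i y := by
  have hl : ContDiff ℝ ∞ fun z : EuclideanSpace ℝ (Fin n) × ℝ => x + z.2 • (z.1 - x) := by
    fun_prop
  have hsm : ∀ i : Fin n, ContDiff ℝ ∞ fun z : EuclideanSpace ℝ (Fin n) × ℝ =>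
      fderiv ℝ u (x + z.2 • (z.1 - x)) (EuclideanSpace.single i 1) := fun i =>
    ((hu.fderiv_right (m := ∞) (by simp)).comp hl).clm_apply contDiff_const
  -- The coefficients are the partial derivatives averaged over the segment from `x` to `y`; the
  -- formula is the fundamental theorem of calculus along it.
  refine ⟨fun i y => ∫ t in (0 : ℝ)..1, fderiv ℝ u (x + t • (y - x)) (EuclideanSpace.single i 1),
    fun i => contDiff_infty.2 fun k => contDiff_intervalIntegral_nat 0 1 k (hsm i), fun y => ?_⟩
  have hder : ∀ t ∈ uIcc (0 : ℝ) 1, HasDerivAt (fun t : ℝ => u (x + t • (y - x)))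
      (fderiv ℝ u (x + t • (y - x)) (y - x)) t := by
    intro t _
    have h1 : HasDerivAt (fun t : ℝ => x + t • (y - x)) (y - x) t := by
      simpa using ((hasDerivAt_id t).smul_const (y - x)).const_add x
    exact ((hu.differentiable (by simp)) _).hasFDerivAt.comp_hasDerivAt t h1
  have hcont : ∀ i : Fin n, Continuous fun t : ℝ =>
      fderiv ℝ u (x + t • (y - x)) (EuclideanSpace.single i 1) := fun i =>
    (hsm i).continuous.comp (by fun_prop : Continuous fun t : ℝ => (y, t))
  have hexp : ∀ t : ℝ, fderiv ℝ u (x + t • (y - x)) (y - x) =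
      ∑ i, (y i - x i) * fderiv ℝ u (x + t • (y - x)) (EuclideanSpace.single i 1) := by
    intro t
    have hyx : y - x = ∑ i, (y i - x i) • EuclideanSpace.single i (1 : ℝ) := by
      ext j; simp [Finset.sum_apply, Pi.single_apply]
    refine (congrArg (fderiv ℝ u (x + t • (y - x))) hyx).trans ?_
    simp only [map_sum, map_smul, smul_eq_mul]
  have hint := intervalIntegral.integral_eq_sub_of_hasDerivAt hder (by
    simp only [hexp]
    exact (continuous_finsetSum _ fun i _ => (hcont i).const_mul _).intervalIntegrable _ _)
  simp only [hexp, one_smul, zero_smul, add_zero, add_sub_cancel] at hint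
  rw [intervalIntegral.integral_finsetSum fun i _ =>
    ((hcont i).const_mul _).intervalIntegrable _ _] at hint
  simp only [intervalIntegral.integral_const_mul] at hint
  linarith

end Analysis

/-! ### Finite-dimensional local real algebras -/

/-- A root of an annihilating polynomial of minimal degree detects nonunits. -/
theorem not_isUnit_of_minpoly_eval_zero {A : Type*} [CommRing A] [Algebra ℝ A] [Module.Finite ℝ A] {a : A}
    (h : (minpoly ℝ a).eval 0 = 0) : ¬ IsUnit a := by
  intro ha
  have hint : IsIntegral ℝ a := Algebra.IsIntegral.isIntegral a
  -- The minimal polynomial is `X * q`. If `a` were a unit, `q` would already annihilate `a`,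
  -- against minimality of the degree.
  obtain ⟨q, hq⟩ := Polynomial.dvd_iff_isRoot.2 (show (minpoly ℝ a).IsRoot 0 from h)
  rw [Polynomial.C_0, sub_zero] at hq
  have hne := minpoly.ne_zero hint
  have hq0 : q ≠ 0 := by rintro rfl; simp [hq] at hne
  have h0 : Polynomial.aeval a q = 0 := by
    have := minpoly.aeval ℝ a
    rw [hq, map_mul, Polynomial.aeval_X] at this
    exact (ha.mul_right_eq_zero).1 this
  have hle := minpoly.degree_le_of_ne_zero ℝ a hq0 h0
  rw [hq, Polynomial.degree_mul, Polynomial.degree_X, Polynomial.degree_eq_natDegree hq0] at hle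
  norm_cast at hle
  omega

section Weil

open IsLocalRing

variable (A : Type*) [CommRing A] [Algebra ℝ A] [IsLocalRing A]

/-- The residue field may be `ℂ`, so there need not be an algebra morphism to `ℝ`. A linear form
suffices: its values are forced on real numbers plus the maximal ideal, and a choice elsewhere. -/
theorem exists_realPart : ∃ r : A →ₗ[ℝ] ℝ, r 1 = 1 ∧ ∀ a ∈ maximalIdeal A, r a = 0 := by
  have h1 : (1 : A) ∉ (maximalIdeal A).restrictScalars ℝ := fun h =>
    (maximalIdeal.isMaximal A).ne_top ((Ideal.eq_top_iff_one _).2 h)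
  obtain ⟨r, hr, hm⟩ := Submodule.exists_le_ker_of_notMem h1
  refine ⟨(r 1)⁻¹ • r, by simp [hr], fun a ha => ?_⟩
  have : r a = 0 := hm ha
  simp [this]

/-- A linear form on a local algebra that vanishes on the maximal ideal and is one at one. -/
def realPart : A →ₗ[ℝ] ℝ := (exists_realPart A).choose

variable {A}

@[simp] theorem realPart_one : realPart A 1 = 1 := (exists_realPart A).choose_spec.1

theorem realPart_of_mem {a : A} (ha : a ∈ maximalIdeal A) : realPart A a = 0 :=
  (exists_realPart A).choose_spec.2 a ha

@[simp] theorem realPart_algebraMap (c : ℝ) : realPart A (algebraMap ℝ A c) = c := by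
  rw [Algebra.algebraMap_eq_smul_one, map_smul, realPart_one, smul_eq_mul, mul_one]

theorem realPart_eq {a : A} {c : ℝ} (h : a - algebraMap ℝ A c ∈ maximalIdeal A) :
    realPart A a = c := by
  have := realPart_of_mem h
  rwa [map_sub, realPart_algebraMap, sub_eq_zero] at this

theorem isUnit_of_sub_algebraMap_mem {a : A} {c : ℝ} (hc : c ≠ 0)
    (h : a - algebraMap ℝ A c ∈ maximalIdeal A) : IsUnit a := by
  by_contra ha
  have h2 : algebraMap ℝ A c ∈ maximalIdeal A := by
    simpa using sub_mem ((mem_maximalIdeal a).2 ha) h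
  exact (mem_maximalIdeal _).1 h2 ((IsUnit.mk0 c hc).map _)

/-- The bound `2 ≤ K` ensures that a Taylor sum with `K` terms contains the linear term. -/
theorem exists_maximalIdeal_pow_eq_bot (A : Type*) [CommRing A] [Algebra ℝ A] [IsLocalRing A]
    [Module.Finite ℝ A] : ∃ K : ℕ, 2 ≤ K ∧ maximalIdeal A ^ K = ⊥ := by
  have : IsArtinianRing A := IsArtinianRing.of_finite ℝ A
  obtain ⟨k, hk⟩ := IsArtinianRing.isNilpotent_jacobson_bot (R := A)
  rw [IsLocalRing.jacobson_eq_maximalIdeal ⊥ bot_ne_top] at hk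
  exact ⟨k + 2, by omega, by rw [pow_add, hk]; simp⟩

end Weil

/-! ### `A`-points and their base points -/

section Points

variable {n : ℕ} {M : Type*} [TopologicalSpace M] [ChartedSpace (EuclideanSpace ℝ (Fin n)) M]

section Alg

variable {A B : Type*} [CommRing A] [Algebra ℝ A] [CommRing B] [Algebra ℝ B]

theorem APoint.lin_mul (p : APoint n M A) (f g : SmoothFun n M) :
    p.lin (f * g) = p.lin f * p.lin g :=
  map_mul (show SmoothFun n M →ₐ[ℝ] A from p) f g

theorem APoint.lin_one (p : APoint n M A) : p.lin 1 = 1 :=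
  map_one (show SmoothFun n M →ₐ[ℝ] A from p)

theorem APoint.lin_algebraMap (p : APoint n M A) (c : ℝ) :
    p.lin (algebraMap ℝ _ c) = algebraMap ℝ A c :=
  AlgHom.commutes (show SmoothFun n M →ₐ[ℝ] A from p) c

theorem APoint.lin_aeval (p : APoint n M A) (f : SmoothFun n M) (Q : Polynomial ℝ) :
    p.lin (Polynomial.aeval f Q) = Polynomial.aeval (p.lin f) Q :=
  (Polynomial.aeval_algHom_apply (show SmoothFun n M →ₐ[ℝ] A from p) f Q).symm

theorem APoint.isUnit_lin (p : APoint n M A) {f : SmoothFun n M} (hf : IsUnit f) :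
    IsUnit (p.lin f) :=
  hf.map (show SmoothFun n M →ₐ[ℝ] A from p)

theorem APoint.ext_lin {p p' : APoint n M A} (h : ∀ f, p.lin f = p'.lin f) : p = p' :=
  AlgHom.ext h

/-- A multiplicative unital linear map as an `A`-point. -/
def APoint.ofLin (D : SmoothFun n M →ₗ[ℝ] A) (h1 : D 1 = 1)
    (hm : ∀ f g, D (f * g) = D f * D g) : APoint n M A :=
  AlgHom.ofLinearMap D h1 hm

@[simp] theorem APoint.ofLin_lin (D : SmoothFun n M →ₗ[ℝ] A) (h1 : D 1 = 1)
    (hm : ∀ f g, D (f * g) = D f * D g) : (APoint.ofLin D h1 hm).lin = D := rfl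

@[simp] theorem natTrans_lin (φ : A →ₐ[ℝ] B) (p : APoint n M A) (f : SmoothFun n M) :
    (natTrans φ p).lin f = φ (p.lin f) := rfl

theorem isUnit_of_forall_ne_zero {f : SmoothFun n M} (hf : ∀ x, f x ≠ 0) : IsUnit f := by
  refine IsUnit.of_mul_eq_one ⟨fun x => (f x)⁻¹, f.contMDiff.inv₀ hf⟩ ?_
  ext x
  exact mul_inv_cancel₀ (hf x)

theorem SmoothFun.aeval_apply (f : SmoothFun n M) (Q : Polynomial ℝ) (x : M) :
    (Polynomial.aeval f Q : SmoothFun n M) x = Q.eval (f x) := by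
  have := Polynomial.aeval_algHom_apply
    ((Pi.evalAlgHom ℝ (fun _ : M => ℝ) x).comp (ContMDiffMap.coeFnAlgHom :
      SmoothFun n M →ₐ[ℝ] M → ℝ)) f Q
  rw [Polynomial.aeval_def, Polynomial.eval₂_eq_eval_map] at this
  simpa using this.symm

end Alg

/-- The point `x` is the base point of `p`. -/
def APoint.IsBase {A : Type*} [CommRing A] [Algebra ℝ A] [IsLocalRing A] (p : APoint n M A)
    (x : M) : Prop :=
  ∀ f, p.lin f - algebraMap ℝ A (f x) ∈ IsLocalRing.maximalIdeal A

section

variable {A B : Type*} [CommRing A] [Algebra ℝ A] [IsLocalRing A]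
  [CommRing B] [Algebra ℝ B] [IsLocalRing B]

theorem APoint.IsBase.realPart_lin {p : APoint n M A} {x : M} (h : p.IsBase x)
    (f : SmoothFun n M) : realPart A (p.lin f) = f x :=
  realPart_eq (h f)

theorem map_mem_maximalIdeal_iff {φ : A →ₐ[ℝ] B} (hφ : Function.Surjective φ) {a : A} :
    φ a ∈ IsLocalRing.maximalIdeal B ↔ a ∈ IsLocalRing.maximalIdeal A := by
  have : IsLocalHom (φ : A →+* B) := IsLocalHom.of_surjective (φ : A →+* B) hφ
  rw [IsLocalRing.mem_maximalIdeal, IsLocalRing.mem_maximalIdeal, mem_nonunits_iff,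
    mem_nonunits_iff]
  exact not_congr (isUnit_map_iff (φ : A →+* B) a)

theorem APoint.IsBase.natTrans {φ : A →ₐ[ℝ] B} (hφ : Function.Surjective φ) {p : APoint n M A}
    {x : M} (hx : p.IsBase x) : (natTrans φ p).IsBase x := by
  intro f
  have := (map_mem_maximalIdeal_iff hφ).2 (hx f)
  rwa [map_sub, AlgHom.commutes] at this

end

variable [T2Space M] [IsManifold (𝓡 n) ∞ M]

theorem exists_bump (x : M) {U : Set M} (hU : U ∈ 𝓝 x) :
    ∃ χ : SmoothFun n M, χ x = 1 ∧ ∀ y ∉ U, χ y = 0 := by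
  obtain ⟨χ, -, hχ⟩ := (SmoothBumpFunction.nhds_basis_support (I := 𝓡 n) hU).mem_iff.1 hU
  exact ⟨⟨χ, χ.contMDiff⟩, χ.eq_one, fun y hy => by
    by_contra h; exact hy (hχ h)⟩

/-- A partition of unity smooths the index function of a compact exhaustion from above. Such a
function replaces compactness of `M` in the search for a base point. -/
theorem exists_exhaustion [SecondCountableTopology M] :
    ∃ h : SmoothFun n M, ∀ c : ℝ, IsCompact {x | h x ≤ c} := by
  have : LocallyCompactSpace M := ChartedSpace.locallyCompactSpace (EuclideanSpace ℝ (Fin n)) M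
  let K : CompactExhaustion M := default
  obtain ⟨h, hh⟩ := exists_contMDiffMap_forall_mem_convex_of_local_const (n := (⊤ : ℕ∞)) (𝓡 n)
    (t := fun x => Set.Ici (K.find x : ℝ)) (fun x => convex_Ici _) (fun x =>
      ⟨(K.find x + 1 : ℕ), by
        filter_upwards [isOpen_interior.mem_nhds (K.subset_interior_succ _ (K.mem_find x))]
          with y hy
        exact Set.mem_Ici.2 (Nat.cast_le.2 (K.mem_iff_find_le.1 (interior_subset hy)))⟩)
  refine ⟨h, fun c => ?_⟩
  refine (K.isCompact ⌈c⌉₊).of_isClosed_subset (isClosed_le h.contMDiff.continuous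
    continuous_const) fun x hx => K.mem_iff_find_le.2 ?_
  have h1 : (K.find x : ℝ) ≤ h x := hh x
  exact_mod_cast (h1.trans hx).trans (Nat.le_ceil c)

section

variable {A : Type*} [CommRing A] [Algebra ℝ A] [IsLocalRing A]

/-- The base point is a common zero of all functions in the kernel of `p`. A nowhere vanishing
function is a unit, so each function in the kernel has a zero; sums of squares handle finitely many
at once, and compactness handles all. -/
theorem APoint.exists_isBase [SecondCountableTopology M] [Module.Finite ℝ A] (p : APoint n M A) :
    ∃ x, p.IsBase x := by
  obtain ⟨h, hh⟩ := exists_exhaustion (n := n) (M := M)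
  have hzero : ∀ f : SmoothFun n M, p.lin f = 0 → ∃ x, f x = 0 := by
    intro f hf
    by_contra! hne
    have := p.isUnit_lin (isUnit_of_forall_ne_zero hne)
    rw [hf] at this
    exact not_isUnit_zero this
  have hmin : ∀ f : SmoothFun n M, p.lin (Polynomial.aeval f (minpoly ℝ (p.lin f))) = 0 :=
    fun f => by rw [p.lin_aeval, minpoly.aeval]
  have hclosed : ∀ f : SmoothFun n M, IsClosed {x | f x = 0} := fun f =>
    isClosed_eq f.contMDiff.continuous continuous_const
  set P := minpoly ℝ (p.lin h) with hP
  have hP0 : P ≠ 0 := minpoly.ne_zero (Algebra.IsIntegral.isIntegral _)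
  set w : SmoothFun n M := Polynomial.aeval h P with hw
  -- Where `w = P(h)` vanishes, `h` takes one of the finitely many roots of `P`, so it is bounded
  -- there.
  have hcomp : IsCompact {x | w x = 0} := by
    obtain ⟨c, hc⟩ := P.roots.toFinset.finite_toSet.bddAbove
    refine (hh c).of_isClosed_subset (hclosed w) fun x hx => hc ?_
    rw [Set.mem_ofPred_eq, hw, SmoothFun.aeval_apply] at hx
    simpa [hP0] using hx
  have hfin := hcomp.inter_iInter_nonempty
    (fun f : {f : SmoothFun n M // p.lin f = 0} => {x | f.1 x = 0}) (fun f => hclosed f.1) (by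
      intro u
      obtain ⟨x, hx⟩ := hzero (w * w + ∑ f ∈ u, f.1 * f.1) (by
        rw [map_add, map_sum, p.lin_mul, hmin h]
        simp [APoint.lin_mul, fun f : {f : SmoothFun n M // p.lin f = 0} => f.2])
      have hsum : (w * w + ∑ f ∈ u, f.1 * f.1 : SmoothFun n M) x =
          w x * w x + ∑ f ∈ u, f.1 x * f.1 x := by
        have := map_sum ((Pi.evalAlgHom ℝ (fun _ : M => ℝ) x).comp (ContMDiffMap.coeFnAlgHom :
          SmoothFun n M →ₐ[ℝ] M → ℝ)) (fun f : {f : SmoothFun n M // p.lin f = 0} => f.1 * f.1) u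
        exact congrArg (w x * w x + ·) this
      rw [hsum, add_eq_zero_iff_of_nonneg (mul_self_nonneg _)
        (Finset.sum_nonneg fun _ _ => mul_self_nonneg _),
        Finset.sum_eq_zero_iff_of_nonneg fun _ _ => mul_self_nonneg _] at hx
      refine ⟨x, mul_self_eq_zero.1 hx.1, Set.mem_iInter₂.2 fun f hf => ?_⟩
      exact mul_self_eq_zero.1 (hx.2 f hf))
  obtain ⟨x, -, hx⟩ := hfin
  refine ⟨x, fun f => ?_⟩
  set g : SmoothFun n M := f - algebraMap ℝ _ (f x) with hg
  have hgx : g x = 0 := sub_self (f x)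
  have hpg : p.lin g = p.lin f - algebraMap ℝ A (f x) := by
    rw [hg, map_sub, p.lin_algebraMap]
  -- The minimal polynomial of `p g`, evaluated at `g`, lies in the kernel of `p` and so vanishes at
  -- `x`. As `g x = 0`, its constant term is zero and `p g` is not a unit.
  have hev := Set.mem_iInter.1 hx ⟨_, hmin g⟩
  rw [Set.mem_ofPred_eq, SmoothFun.aeval_apply, hgx] at hev
  rw [← hpg, IsLocalRing.mem_maximalIdeal]
  exact not_isUnit_of_minpoly_eval_zero hev

theorem APoint.IsBase.unique {p : APoint n M A} {x y : M} (hx : p.IsBase x) (hy : p.IsBase y) :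
    x = y := by
  by_contra hne
  obtain ⟨χ, h1, h0⟩ := exists_bump (n := n) x (isOpen_compl_singleton.mem_nhds hne : {y}ᶜ ∈ 𝓝 x)
  have := (hx.realPart_lin χ).symm.trans (hy.realPart_lin χ)
  rw [h1, h0 y (by simp)] at this
  exact one_ne_zero this

/-- A bump function `χ` at `x` kills `f - g`, while its image under `p` is a unit because `χ x = 1`.
-/
theorem APoint.IsBase.congr {p : APoint n M A} {x : M} (hx : p.IsBase x) {f g : SmoothFun n M}
    (h : ∀ᶠ y in 𝓝 x, f y = g y) : p.lin f = p.lin g := by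
  obtain ⟨χ, h1, h0⟩ := exists_bump (n := n) x h
  have hm : χ * (f - g) = 0 := by
    ext y
    by_cases hy : f y = g y
    · exact mul_eq_zero_of_right _ (sub_eq_zero.2 hy)
    · exact mul_eq_zero_of_left (h0 y hy) _
  have hu : IsUnit (p.lin χ) := isUnit_of_sub_algebraMap_mem one_ne_zero (h1 ▸ hx χ)
  have := congrArg p.lin hm
  rw [p.lin_mul, map_zero, hu.mul_right_eq_zero, map_sub, sub_eq_zero] at this
  exact this

end

end Points

/-! ### Taylor's formula with nilpotent increments -/

section Taylor

open IsLocalRing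

variable {n : ℕ} {A : Type*} [NormedCommRing A] [NormedAlgebra ℝ A]

/-- The constant vector field `∑ ν i ∂ᵢ` with coefficients in `A`, acting on `A`-valued functions. -/
def shiftDeriv (ν : Fin n → A) (F : EuclideanSpace ℝ (Fin n) → A) :
    EuclideanSpace ℝ (Fin n) → A :=
  fun y => ∑ i, ν i * fderiv ℝ F y (EuclideanSpace.single i 1)

theorem contDiff_shiftDeriv {X : Type*} [NormedAddCommGroup X] [NormedSpace ℝ X]
    {ν : X → Fin n → A} (hν : ContDiff ℝ ∞ ν) {G : X → EuclideanSpace ℝ (Fin n) → A}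
    (hG : ContDiff ℝ ∞ (Function.uncurry G)) :
    ContDiff ℝ ∞ (Function.uncurry fun x => shiftDeriv (ν x) (G x)) := by
  unfold Function.uncurry shiftDeriv
  refine ContDiff.sum fun i _ => ?_
  refine ContDiff.mul (((contDiff_pi.1 hν) i).comp contDiff_fst) ?_
  refine ContDiff.clm_apply ?_ contDiff_const
  exact ContDiff.fderiv (f := fun z : X × EuclideanSpace ℝ (Fin n) => G z.1)
    (hG.comp ((contDiff_fst.comp contDiff_fst).prodMk contDiff_snd)) contDiff_snd (by simp)

theorem contDiff_shiftDeriv_iterate {X : Type*} [NormedAddCommGroup X] [NormedSpace ℝ X]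
    {ν : X → Fin n → A} (hν : ContDiff ℝ ∞ ν) {F : EuclideanSpace ℝ (Fin n) → A}
    (hF : ContDiff ℝ ∞ F) (j : ℕ) :
    ContDiff ℝ ∞ (Function.uncurry fun x => (shiftDeriv (ν x))^[j] F) := by
  induction j with
  | zero => exact hF.comp contDiff_snd
  | succ j ih =>
    simp only [Function.iterate_succ', Function.comp_apply]
    exact contDiff_shiftDeriv hν ih

variable (n A) in
/-- The algebra of smooth `A`-valued functions on `ℝⁿ`. -/
def smoothFunctions : Subalgebra ℝ (EuclideanSpace ℝ (Fin n) → A) where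
  carrier := {F | ContDiff ℝ ∞ F}
  mul_mem' := fun {F G} (hF : ContDiff ℝ ∞ F) (hG : ContDiff ℝ ∞ G) => hF.mul hG
  add_mem' := fun {F G} (hF : ContDiff ℝ ∞ F) (hG : ContDiff ℝ ∞ G) => hF.add hG
  algebraMap_mem' c := (contDiff_const : ContDiff ℝ ∞ fun _ => algebraMap ℝ A c)

theorem contDiff_coe (F : smoothFunctions n A) : ContDiff ℝ ∞ F.1 := F.2

/-- The vector field `∑ ν i ∂ᵢ` as an operator on smooth functions. -/
def shiftEnd (ν : Fin n → A) : Module.End ℝ (smoothFunctions n A) where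
  -- Smoothness comes from the parametrized version with a dummy parameter in `ℝ`, set to `0`.
  toFun F := ⟨shiftDeriv ν F.1, (contDiff_shiftDeriv (X := ℝ) (ν := fun _ => ν)
    (G := fun _ => F.1) contDiff_const ((contDiff_coe F).comp contDiff_snd)).comp
      (contDiff_const (c := (0 : ℝ)) |>.prodMk contDiff_id)⟩
  map_add' F G := by
    ext y
    have hF := ((contDiff_coe F).differentiable (by simp)) y
    have hG := ((contDiff_coe G).differentiable (by simp)) y
    change ∑ i, ν i * fderiv ℝ (F.1 + G.1) y (EuclideanSpace.single i 1) =
      ∑ i, ν i * fderiv ℝ F.1 y (EuclideanSpace.single i 1) +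
      ∑ i, ν i * fderiv ℝ G.1 y (EuclideanSpace.single i 1)
    simp only [← Finset.sum_add_distrib, ← mul_add]
    refine Finset.sum_congr rfl fun i _ => ?_
    rw [fderiv_add hF hG]
    rfl
  map_smul' c F := by
    ext y
    have hF := ((contDiff_coe F).differentiable (by simp)) y
    change ∑ i, ν i * fderiv ℝ (c • F.1) y (EuclideanSpace.single i 1) =
      c • ∑ i, ν i * fderiv ℝ F.1 y (EuclideanSpace.single i 1)
    simp only [Finset.smul_sum]
    refine Finset.sum_congr rfl fun i _ => ?_
    rw [fderiv_const_smul hF, FunLike.coe_smul, Pi.smul_apply, mul_smul_comm]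

theorem shiftEnd_mul (ν : Fin n → A) (F G : smoothFunctions n A) :
    shiftEnd ν (F * G) = F * shiftEnd ν G + shiftEnd ν F * G := by
  ext y
  have hF := ((contDiff_coe F).differentiable (by simp)) y
  have hG := ((contDiff_coe G).differentiable (by simp)) y
  change ∑ i, ν i * fderiv ℝ (F.1 * G.1) y (EuclideanSpace.single i 1) =
    F.1 y * ∑ i, ν i * fderiv ℝ G.1 y (EuclideanSpace.single i 1) +
    (∑ i, ν i * fderiv ℝ F.1 y (EuclideanSpace.single i 1)) * G.1 y
  rw [Finset.mul_sum, Finset.sum_mul, ← Finset.sum_add_distrib]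
  refine Finset.sum_congr rfl fun i _ => ?_
  rw [fderiv_mul hF hG]
  simp only [FunLike.coe_add, Pi.add_apply, FunLike.coe_smul, Pi.smul_apply, smul_eq_mul]
  ring

theorem shiftEnd_pow_apply (ν : Fin n → A) (F : smoothFunctions n A) (j : ℕ) :
    ((shiftEnd ν ^ j) F).1 = (shiftDeriv ν)^[j] F.1 := by
  induction j with
  | zero => rfl
  | succ j ih =>
    rw [pow_succ', Function.iterate_succ', Function.comp_apply, ← ih]
    rfl

/-- A subspace is cut out by linear forms, and in finite dimension these are continuous and commute
with differentiation. -/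
theorem fderiv_mem_submodule {E V : Type*} [NormedAddCommGroup E] [NormedSpace ℝ E]
    [NormedAddCommGroup V] [NormedSpace ℝ V] [FiniteDimensional ℝ V] (J : Submodule ℝ V)
    {F : E → V} {y : E} (hd : DifferentiableAt ℝ F y) (hF : ∀ z, F z ∈ J) (v : E) :
    fderiv ℝ F y v ∈ J := by
  by_contra h
  obtain ⟨l, hl, hJ⟩ := Submodule.exists_le_ker_of_notMem h
  have h0 : (fun z => LinearMap.toContinuousLinearMap l (F z)) = fun _ => 0 :=
    funext fun z => hJ (hF z)
  have := congrArg (fun g => fderiv ℝ g y v) h0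
  rw [fderiv_fun_const] at this
  have h2 := ((LinearMap.toContinuousLinearMap l).hasFDerivAt.comp y hd.hasFDerivAt).fderiv
  apply hl
  change fderiv ℝ (LinearMap.toContinuousLinearMap l ∘ F) y v = 0 at this
  rw [h2] at this
  exact this

/-- The truncated Taylor series in the directions `ν`. -/
def taylorSum (K : ℕ) (ν : Fin n → A) (F : EuclideanSpace ℝ (Fin n) → A) :
    EuclideanSpace ℝ (Fin n) → A :=
  fun y => ∑ j ∈ Finset.range K, (j.factorial : ℝ)⁻¹ • (shiftDeriv ν)^[j] F y

theorem taylorSum_add (K : ℕ) (ν : Fin n → A) (F G : smoothFunctions n A)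
    (y : EuclideanSpace ℝ (Fin n)) :
    taylorSum K ν (F + G).1 y = taylorSum K ν F.1 y + taylorSum K ν G.1 y := by
  simp only [taylorSum, ← shiftEnd_pow_apply, map_add, ← Finset.sum_add_distrib, ← smul_add]
  rfl

theorem taylorSum_smul (K : ℕ) (ν : Fin n → A) (c : ℝ) (F : smoothFunctions n A)
    (y : EuclideanSpace ℝ (Fin n)) :
    taylorSum K ν (c • F).1 y = c • taylorSum K ν F.1 y := by
  simp only [taylorSum, ← shiftEnd_pow_apply, map_smul, Finset.smul_sum]
  exact Finset.sum_congr rfl fun j _ => smul_comm _ _ _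

theorem shiftDeriv_const (ν : Fin n → A) (c : A) : shiftDeriv ν (fun _ => c) = fun _ => 0 := by
  ext y; simp [shiftDeriv]

theorem shiftDeriv_iterate_zero (ν : Fin n → A) (j : ℕ) :
    (shiftDeriv ν)^[j] (fun _ => (0 : A)) = fun _ => 0 :=
  Function.iterate_fixed (shiftDeriv_const ν 0) j

theorem taylorSum_const {K : ℕ} (hK : 2 ≤ K) (ν : Fin n → A) (c : A)
    (y : EuclideanSpace ℝ (Fin n)) : taylorSum K ν (fun _ => c) y = c := by
  obtain ⟨K, rfl⟩ := Nat.exists_eq_add_of_le' (by omega : 1 ≤ K)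
  simp [taylorSum, Finset.sum_range_succ', shiftDeriv_const, shiftDeriv_iterate_zero]

theorem shiftDeriv_coord (ν : Fin n → A) (i : Fin n) :
    shiftDeriv ν (fun y => algebraMap ℝ A (y i)) = fun _ => ν i := by
  ext y
  have : (fun y : EuclideanSpace ℝ (Fin n) => algebraMap ℝ A (y i)) =
      (algebraMapCLM ℝ A).comp (EuclideanSpace.proj i) := rfl
  simp only [shiftDeriv]
  rw [this]
  simp [ContinuousLinearMap.fderiv]

theorem taylorSum_coord {K : ℕ} (hK : 2 ≤ K) (ν : Fin n → A) (i : Fin n)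
    (y : EuclideanSpace ℝ (Fin n)) :
    taylorSum K ν (fun y => algebraMap ℝ A (y i)) y = algebraMap ℝ A (y i) + ν i := by
  obtain ⟨K, rfl⟩ := Nat.exists_eq_add_of_le' hK
  simp [taylorSum, Finset.sum_range_succ', shiftDeriv_coord, shiftDeriv_const,
    shiftDeriv_iterate_zero, add_comm]

variable [IsLocalRing A]

/-- The real part of a tuple of elements of `A`, as a point of `ℝⁿ`. -/
def realPoint (a : Fin n → A) : EuclideanSpace ℝ (Fin n) :=
  WithLp.toLp 2 fun i => realPart A (a i)

/-- The tuple differs from its real part by elements of the maximal ideal. -/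
def IsNearReal (a : Fin n → A) : Prop :=
  ∀ i, a i - algebraMap ℝ A (realPart A (a i)) ∈ maximalIdeal A

variable [Module.Finite ℝ A]

/-- Each application contributes one factor `ν i`, and differentiation does not leave the subspace
`maximalIdeal A ^ j`. -/
theorem shiftDeriv_iterate_mem {ν : Fin n → A} (hν : ∀ i, ν i ∈ maximalIdeal A)
    (F : smoothFunctions n A) (j : ℕ) (y : EuclideanSpace ℝ (Fin n)) :
    (shiftDeriv ν)^[j] F.1 y ∈ maximalIdeal A ^ j := by
  induction j generalizing y with
  | zero => simp
  | succ j ih =>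
    rw [Function.iterate_succ', Function.comp_apply, pow_succ']
    refine sum_mem fun i _ => Ideal.mul_mem_mul (hν i) ?_
    refine fderiv_mem_submodule ((maximalIdeal A ^ j).restrictScalars ℝ) ?_ ih _
    rw [← shiftEnd_pow_apply]
    exact ((contDiff_coe ((shiftEnd ν ^ j) F)).differentiable (by simp)) y

theorem shiftEnd_pow_eq_zero {ν : Fin n → A} (hν : ∀ i, ν i ∈ maximalIdeal A) {K : ℕ}
    (hK : maximalIdeal A ^ K = ⊥) : shiftEnd ν ^ K = 0 := by
  ext F y
  have := shiftDeriv_iterate_mem hν F K y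
  rw [hK, ← shiftEnd_pow_apply] at this
  exact this

/-- The exponential of a nilpotent derivation is multiplicative. -/
theorem taylorSum_mul {ν : Fin n → A} (hν : ∀ i, ν i ∈ maximalIdeal A) {K : ℕ}
    (hK : maximalIdeal A ^ K = ⊥) (F G : smoothFunctions n A) (y : EuclideanSpace ℝ (Fin n)) :
    taylorSum K ν (F.1 * G.1) y = taylorSum K ν F.1 y * taylorSum K ν G.1 y := by
  -- `IsNilpotent.exp` takes its inverse factorials in `ℚ`.
  let _ : Module ℚ (smoothFunctions n A) := Module.compHom _ (algebraMap ℚ ℝ)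
  have hnil := shiftEnd_pow_eq_zero hν hK
  have hexp : ∀ F : smoothFunctions n A,
      (IsNilpotent.exp (shiftEnd ν) F).1 y = taylorSum K ν F.1 y := by
    intro F
    have hs : IsNilpotent.exp (shiftEnd ν) F =
        ∑ j ∈ Finset.range K, (j.factorial : ℝ)⁻¹ • (shiftEnd ν ^ j) F := by
      rw [IsNilpotent.exp_eq_sum hnil, LinearMap.sum_apply]
      refine Finset.sum_congr rfl fun j _ => ?_
      change algebraMap ℚ ℝ _ • (shiftEnd ν ^ j) F = _
      simp
    rw [hs]
    simp [taylorSum, ← shiftEnd_pow_apply]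
  have := Module.End.exp_mul_of_derivation ℝ (smoothFunctions n A) (shiftEnd ν)
    (shiftEnd_mul ν) ⟨K, hnil⟩ F G
  rw [← hexp F, ← hexp G]
  exact (hexp (F * G)).symm.trans (congrFun (congrArg Subtype.val this) y)

theorem taylorSum_sub_mem {ν : Fin n → A} (hν : ∀ i, ν i ∈ maximalIdeal A) {K : ℕ} (hK : 2 ≤ K)
    (F : smoothFunctions n A) (y : EuclideanSpace ℝ (Fin n)) :
    taylorSum K ν F.1 y - F.1 y ∈ maximalIdeal A := by
  obtain ⟨K, rfl⟩ := Nat.exists_eq_add_of_le' (by omega : 1 ≤ K)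
  rw [taylorSum, Finset.sum_range_succ']
  simp only [Nat.factorial_zero, Nat.cast_one, inv_one, Function.iterate_zero, id_eq, one_smul,
    add_sub_cancel_right]
  refine sum_mem fun j _ => ?_
  rw [Algebra.smul_def]
  refine Ideal.mul_mem_left _ _ (Ideal.pow_le_self (Nat.succ_ne_zero j) ?_)
  exact shiftDeriv_iterate_mem hν F (j + 1) y

variable (A) in
/-- An exponent of nilpotency of the maximal ideal, at least two. -/
def nilOrder : ℕ := (exists_maximalIdeal_pow_eq_bot A).choose

theorem two_le_nilOrder : 2 ≤ nilOrder A := (exists_maximalIdeal_pow_eq_bot A).choose_spec.1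

theorem maximalIdeal_pow_nilOrder : maximalIdeal A ^ nilOrder A = ⊥ :=
  (exists_maximalIdeal_pow_eq_bot A).choose_spec.2

/-- The value of `u` at the `A`-valued point `a`, by Taylor's formula. -/
def taylorEval (u : EuclideanSpace ℝ (Fin n) → ℝ) (a : Fin n → A) : A :=
  taylorSum (nilOrder A) (fun i => a i - algebraMap ℝ A (realPart A (a i)))
    (fun y => algebraMap ℝ A (u y)) (realPoint a)

/-- Both the real point and the increment depend linearly on `a`, and the Taylor sum is jointly
smooth in them. This makes the inverse charts of `M^A` smooth. -/
theorem contDiff_taylorEval {u : EuclideanSpace ℝ (Fin n) → ℝ} (hu : ContDiff ℝ ∞ u) :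
    ContDiff ℝ ∞ (taylorEval u : (Fin n → A) → A) := by
  have hr : ∀ i, ContDiff ℝ ∞ fun a : Fin n → A => realPart A (a i) := fun i =>
    ((LinearMap.toContinuousLinearMap (realPart A)).contDiff).comp (contDiff_apply ℝ A i)
  have hx : ContDiff ℝ ∞ (realPoint : (Fin n → A) → _) := contDiff_euclidean.2 hr
  have hν : ContDiff ℝ ∞ fun (a : Fin n → A) (i : Fin n) =>
      a i - algebraMap ℝ A (realPart A (a i)) := contDiff_pi.2 fun i =>
    (contDiff_apply ℝ A i).sub ((algebraMapCLM ℝ A).contDiff.comp (hr i))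
  unfold taylorEval taylorSum
  refine ContDiff.sum fun j _ => ContDiff.const_smul _ ?_
  exact (contDiff_shiftDeriv_iterate hν ((algebraMapCLM ℝ A).contDiff.comp hu) j).comp
    (contDiff_id.prodMk hx)

theorem SmoothFun.contDiff (f : SmoothFun n (EuclideanSpace ℝ (Fin n))) : ContDiff ℝ ∞ f :=
  f.contMDiff.contDiff

/-- A smooth real function on `ℝⁿ` as a smooth `A`-valued function. -/
def SmoothFun.toSmoothFunctions (f : SmoothFun n (EuclideanSpace ℝ (Fin n))) :
    smoothFunctions n A :=
  ⟨fun y => algebraMap ℝ A (f y), ContDiff.comp (algebraMapCLM ℝ A).contDiff (SmoothFun.contDiff f)⟩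

/-- The `A`-point of `ℝⁿ` with given coordinates. -/
def euclideanPoint (a : Fin n → A) (ha : IsNearReal a) : APoint n (EuclideanSpace ℝ (Fin n)) A :=
  APoint.ofLin
    { toFun := fun f => taylorEval f a
      map_add' := fun f g => by
        refine Eq.trans ?_ (taylorSum_add (nilOrder A) _ f.toSmoothFunctions g.toSmoothFunctions _)
        refine congrArg (fun F => taylorSum _ _ F _) (funext fun y => ?_)
        exact map_add (algebraMap ℝ A) (f y) (g y)
      map_smul' := fun c f => by
        refine Eq.trans ?_ (taylorSum_smul (nilOrder A) _ c f.toSmoothFunctions _)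
        refine congrArg (fun F => taylorSum _ _ F _) (funext fun y => ?_)
        exact (algebraMapCLM ℝ A).map_smul c (f y) }
    (by
      refine Eq.trans ?_ (taylorSum_const (two_le_nilOrder (A := A))
        (fun i => a i - algebraMap ℝ A (realPart A (a i))) 1 (realPoint a))
      exact congrArg (fun F => taylorSum _ _ F _) (funext fun y => map_one (algebraMap ℝ A)))
    (fun f g => by
      refine Eq.trans ?_ (taylorSum_mul ha maximalIdeal_pow_nilOrder f.toSmoothFunctions
        g.toSmoothFunctions _)
      refine congrArg (fun F => taylorSum _ _ F _) (funext fun y => ?_)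
      exact map_mul _ _ _)

theorem euclideanPoint_isBase (a : Fin n → A) (ha : IsNearReal a) :
    (euclideanPoint a ha).IsBase (realPoint a) := fun f =>
  taylorSum_sub_mem (ν := fun i => a i - algebraMap ℝ A (realPart A (a i))) ha two_le_nilOrder
     (f.toSmoothFunctions (A := A)) _

theorem taylorEval_coord (a : Fin n → A) (i : Fin n) :
    taylorEval (fun y => y i) a = a i := by
  rw [taylorEval, taylorSum_coord two_le_nilOrder]
  simp [realPoint]

end Taylor

/-! ### Local coordinates of `A`-points -/

section Coordinates

open IsLocalRing

variable {n : ℕ} {M : Type*} [TopologicalSpace M] [ChartedSpace (EuclideanSpace ℝ (Fin n)) M]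

variable (n M) in
/-- Coordinates on an open set of `M`, given by globally defined smooth functions, together with an
extension operator from smooth functions on the open set to smooth functions on `ℝⁿ`. -/
structure LocalCoord where
  dom : Set M
  isOpen_dom : IsOpen dom
  coord : Fin n → SmoothFun n M
  tgt : Set (EuclideanSpace ℝ (Fin n))
  isOpen_tgt : IsOpen tgt
  inv : EuclideanSpace ℝ (Fin n) → M
  inv_mem : ∀ y ∈ tgt, inv y ∈ dom
  chart_mem : ∀ x ∈ dom, WithLp.toLp 2 (fun i => coord i x) ∈ tgt
  inv_chart : ∀ x ∈ dom, inv (WithLp.toLp 2 fun i => coord i x) = x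
  coord_inv : ∀ y ∈ tgt, ∀ i, coord i (inv y) = y i
  -- Only linearity is required globally. On `tgt` the operator is composition with `inv`, hence
  -- multiplicative, which is enough because points depend only on germs.
  ext : SmoothFun n M →ₗ[ℝ] SmoothFun n (EuclideanSpace ℝ (Fin n))
  ext_apply : ∀ f, ∀ y ∈ tgt, ext f y = f (inv y)

/-- Multiplying by a bump function makes the chart components, and the functions read in the chart,
global. The domain is the preimage of the ball on which the bump function is `1`, so nothing changes
there. -/
theorem exists_localCoord [T2Space M] [IsManifold (𝓡 n) ∞ M] (x₀ : M) :
    ∃ c : LocalCoord n M, x₀ ∈ c.dom := by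
  obtain ⟨χ⟩ : Nonempty (SmoothBumpFunction (𝓡 n) x₀) := inferInstance
  set e := extChartAt (𝓡 n) x₀ with he
  have hball : Metric.closedBall (e x₀) χ.rOut ⊆ e.target := by
    have := χ.closedBall_subset
    rwa [ModelWithCorners.range_eq_univ, Set.inter_univ] at this
  have htgt : IsOpen e.target := isOpen_extChartAt_target x₀
  have hsub : Metric.ball (e x₀) χ.rIn ⊆ e.target := fun y hy =>
    hball (Metric.ball_subset_closedBall (Metric.ball_subset_ball χ.rIn_lt_rOut.le hy))
  have hsm : ∀ f : SmoothFun n M, ContDiff ℝ ∞ fun y => χ.toContDiffBump y * f (e.symm y) := by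
    intro f
    refine contDiff_iff_contDiffAt.2 fun y => ?_
    -- Outside the chart target the product vanishes near `y`, since the support of the bump
    -- function is a closed ball inside the target.
    by_cases hy : y ∈ e.target
    · have h1 : ContDiffOn ℝ ∞ (f ∘ e.symm) e.target :=
        (f.contMDiff.comp_contMDiffOn (contMDiffOn_extChartAt_symm x₀)).contDiffOn
      exact χ.toContDiffBump.contDiffAt.mul (h1.contDiffAt (htgt.mem_nhds hy))
    · have h0 : y ∉ tsupport χ.toContDiffBump := fun h => hy (hball (by
        rwa [ContDiffBump.tsupport_eq] at h))
      refine (contDiffAt_const (c := (0 : ℝ))).congr_of_eventuallyEq ?_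
      filter_upwards [notMem_tsupport_iff_eventuallyEq.1 h0] with z hz
      rw [hz, Pi.zero_apply, zero_mul]
  have hcoord : ContMDiff (𝓡 n) 𝓘(ℝ, EuclideanSpace ℝ (Fin n)) ∞ fun x => χ x • e x :=
    χ.contMDiff_smul (contMDiffOn_extChartAt (I := 𝓡 n))
  set coord : Fin n → SmoothFun n M := fun i => ⟨fun x => (χ x • e x) i,
    ((EuclideanSpace.proj (𝕜 := ℝ) i : EuclideanSpace ℝ (Fin n) →L[ℝ] ℝ).contDiff.contMDiff).comp
      hcoord⟩
  have hsrc : e.source = (chartAt (EuclideanSpace ℝ (Fin n)) x₀).source :=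
    extChartAt_source (𝓡 n) x₀
  have hcoord_eq : ∀ x ∈ e.source ∩ e ⁻¹' Metric.ball (e x₀) χ.rIn,
      ∀ i, coord i x = e x i := by
    intro x hx i
    have h1 : χ x = 1 := χ.one_of_dist_le (hsrc ▸ hx.1) (Metric.mem_ball.1 hx.2).le
    change (χ x • e x) i = e x i
    rw [h1, one_smul]
  have hchart : ∀ x ∈ e.source ∩ e ⁻¹' Metric.ball (e x₀) χ.rIn,
      WithLp.toLp 2 (fun i => coord i x) = e x := by
    intro x hx
    ext i
    exact hcoord_eq x hx i
  have hinv : ∀ y ∈ Metric.ball (e x₀) χ.rIn,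
      e.symm y ∈ e.source ∩ e ⁻¹' Metric.ball (e x₀) χ.rIn := fun y hy =>
    ⟨e.map_target (hsub hy), by rwa [Set.mem_preimage, e.right_inv (hsub hy)]⟩
  refine ⟨{
    dom := e.source ∩ e ⁻¹' Metric.ball (e x₀) χ.rIn
    isOpen_dom := (continuousOn_extChartAt x₀).isOpen_inter_preimage
      (isOpen_extChartAt_source x₀) Metric.isOpen_ball
    coord := coord
    tgt := Metric.ball (e x₀) χ.rIn
    isOpen_tgt := Metric.isOpen_ball
    inv := e.symm
    inv_mem := hinv
    chart_mem := fun x hx => (hchart x hx).symm ▸ hx.2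
    inv_chart := fun x hx => by rw [hchart x hx, e.left_inv hx.1]
    coord_inv := fun y hy i => by rw [hcoord_eq _ (hinv y hy), e.right_inv (hsub hy)]
    ext := {
      toFun := fun f => ⟨_, (hsm f).contMDiff⟩
      map_add' := fun f g => by ext y; exact mul_add _ _ _
      map_smul' := fun r f => by ext y; exact mul_left_comm _ _ _ }
    ext_apply := fun f y hy => by
      change χ.toContDiffBump y * f (e.symm y) = f (e.symm y)
      rw [χ.toContDiffBump.one_of_mem_closedBall (Metric.ball_subset_closedBall hy), one_mul] },
    mem_extChartAt_source x₀, Metric.mem_ball_self χ.rIn_pos⟩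

namespace LocalCoord

variable (c : LocalCoord n M)

/-- The values of an `A`-point on the coordinates. -/
def coords {A : Type*} [CommRing A] [Algebra ℝ A] (p : APoint n M A) : Fin n → A :=
  fun i => p.lin (c.coord i)

theorem contMDiff_chart : ContMDiff (𝓡 n) 𝓘(ℝ, EuclideanSpace ℝ (Fin n)) ∞
    fun x => (WithLp.toLp 2 fun i => c.coord i x : EuclideanSpace ℝ (Fin n)) :=
  ((PiLp.continuousLinearEquiv 2 ℝ fun _ : Fin n => ℝ).symm.contDiff.contMDiff).comp
    (contMDiff_pi_space.2 fun i => (c.coord i).contMDiff)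

section

variable {A : Type*} [CommRing A] [Algebra ℝ A] [IsLocalRing A]

variable (A) in
/-- The set of `A`-points with base point in the domain. -/
def pointsOver : Set (APoint n M A) := {p | ∃ x ∈ c.dom, p.IsBase x}

variable {c} in
theorem isNearReal_coords {p : APoint n M A} {x : M} (hp : p.IsBase x) (i : Fin n) :
    c.coords p i - algebraMap ℝ A (realPart A (c.coords p i)) ∈ maximalIdeal A := by
  rw [coords, hp.realPart_lin]
  exact hp _

variable {c} in
theorem realPoint_coords {p : APoint n M A} {x : M} (hp : p.IsBase x) :
    (WithLp.toLp 2 fun i => realPart A (c.coords p i)) = WithLp.toLp 2 fun i => c.coord i x := by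
  ext i
  exact hp.realPart_lin _

variable [T2Space M] [IsManifold (𝓡 n) ∞ M]

/-- The functions `g` are chosen before `p`, so that one expansion compares two points with the same
base point. -/
theorem hadamard_expansion (f : SmoothFun n M) {x : M} (hx : x ∈ c.dom) :
    ∃ g : Fin n → SmoothFun n M, ∀ p : APoint n M A, p.IsBase x →
      p.lin f = algebraMap ℝ A (f x) +
        ∑ i, (c.coords p i - algebraMap ℝ A (c.coord i x)) * p.lin (g i) := by
  obtain ⟨g, hg, hu⟩ := exists_hadamard (SmoothFun.contDiff (c.ext f))
    (WithLp.toLp 2 fun i => c.coord i x)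
  refine ⟨fun i => ⟨_, ((hg i).contMDiff).comp c.contMDiff_chart⟩, fun p hp => ?_⟩
  set G : Fin n → SmoothFun n M := fun i => ⟨_, ((hg i).contMDiff).comp c.contMDiff_chart⟩
  have hf : p.lin f = p.lin (algebraMap ℝ _ (f x) +
      ∑ i, (c.coord i - algebraMap ℝ _ (c.coord i x)) * G i) := by
    refine hp.congr ?_
    filter_upwards [c.isOpen_dom.mem_nhds hx] with y hy
    have h1 := hu (WithLp.toLp 2 fun i => c.coord i y)
    rw [c.ext_apply _ _ (c.chart_mem y hy), c.ext_apply _ _ (c.chart_mem x hx), c.inv_chart y hy,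
      c.inv_chart x hx] at h1
    rw [h1]
    have := map_sum ((Pi.evalAlgHom ℝ (fun _ : M => ℝ) y).comp (ContMDiffMap.coeFnAlgHom :
      SmoothFun n M →ₐ[ℝ] M → ℝ))
      (fun i => (c.coord i - algebraMap ℝ _ (c.coord i x)) * G i) Finset.univ
    exact congrArg (f x + ·) this.symm
  rw [hf, map_add, p.lin_algebraMap, map_sum]
  congr 1
  refine Finset.sum_congr rfl fun i _ => ?_
  rw [p.lin_mul, map_sub, p.lin_algebraMap]
  rfl

variable [Module.Finite ℝ A]

/-- The real parts of the coordinates give the same base point. Each Hadamard expansion then gains a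
factor in the maximal ideal, so the difference of the points lies in all its powers. -/
theorem eq_of_coords_eq {p p' : APoint n M A} (hp : p ∈ c.pointsOver A) (hp' : p' ∈ c.pointsOver A)
    (h : c.coords p = c.coords p') : p = p' := by
  obtain ⟨x, hx, hpx⟩ := hp
  obtain ⟨x', hx', hpx'⟩ := hp'
  obtain rfl : x = x' := by
    rw [← c.inv_chart x hx, ← c.inv_chart x' hx', ← realPoint_coords hpx,
      ← realPoint_coords hpx', h]
  have key : ∀ (k : ℕ) (f : SmoothFun n M), p.lin f - p'.lin f ∈ maximalIdeal A ^ k := by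
    intro k
    induction k with
    | zero => simp
    | succ k ih =>
      intro f
      obtain ⟨g, hg⟩ := c.hadamard_expansion (A := A) f hx
      rw [hg p hpx, hg p' hpx', ← h, add_sub_add_left_eq_sub, ← Finset.sum_sub_distrib, pow_succ']
      refine sum_mem fun i _ => ?_
      rw [← mul_sub]
      exact Ideal.mul_mem_mul (hpx _) (ih _)
  obtain ⟨K, -, hK⟩ := exists_maximalIdeal_pow_eq_bot A
  refine APoint.ext_lin fun f => sub_eq_zero.1 ?_
  have := key K f
  rwa [hK] at this

end

variable {A : Type*} [NormedCommRing A] [NormedAlgebra ℝ A] [IsLocalRing A]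

variable (A) in
/-- The tuples that are coordinates of `A`-points. -/
def range : Set (Fin n → A) := {a | IsNearReal a ∧ realPoint a ∈ c.tgt}

theorem coords_mem_range {p : APoint n M A} (hp : p ∈ c.pointsOver A) : c.coords p ∈ c.range A := by
  obtain ⟨x, hx, hpx⟩ := hp
  refine ⟨isNearReal_coords hpx, ?_⟩
  rw [realPoint, realPoint_coords hpx]
  exact c.chart_mem x hx

variable [Module.Finite ℝ A]

/-- The `A`-point with given coordinates. -/
def pointOf (a : Fin n → A) (ha : a ∈ c.range A) : APoint n M A :=
  APoint.ofLin ((euclideanPoint a ha.1).lin.comp c.ext)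
    (by
      rw [← (euclideanPoint a ha.1).lin_one]
      refine (euclideanPoint_isBase a ha.1).congr ?_
      filter_upwards [c.isOpen_tgt.mem_nhds ha.2] with y hy
      exact c.ext_apply _ _ hy)
    (fun f g => by
      simp only [LinearMap.comp_apply]
      rw [← APoint.lin_mul]
      refine (euclideanPoint_isBase a ha.1).congr ?_
      filter_upwards [c.isOpen_tgt.mem_nhds ha.2] with y hy
      change c.ext (f * g) y = c.ext f y * c.ext g y
      rw [c.ext_apply _ _ hy, c.ext_apply _ _ hy, c.ext_apply _ _ hy]
      rfl)

theorem pointOf_lin (a : Fin n → A) (ha : a ∈ c.range A) (f : SmoothFun n M) :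
    (c.pointOf a ha).lin f = taylorEval (c.ext f) a := rfl

theorem pointOf_isBase (a : Fin n → A) (ha : a ∈ c.range A) :
    (c.pointOf a ha).IsBase (c.inv (realPoint a)) := by
  intro f
  rw [← c.ext_apply f _ ha.2]
  exact euclideanPoint_isBase a ha.1 (c.ext f)

theorem pointOf_mem_pointsOver (a : Fin n → A) (ha : a ∈ c.range A) : c.pointOf a ha ∈ c.pointsOver A :=
  ⟨_, c.inv_mem _ ha.2, c.pointOf_isBase a ha⟩

theorem coords_pointOf (a : Fin n → A) (ha : a ∈ c.range A) :
    c.coords (c.pointOf a ha) = a := by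
  ext i
  refine Eq.trans ?_ (taylorEval_coord a i)
  have hsm : ContMDiff (𝓡 n) 𝓘(ℝ, ℝ) ∞ fun y : EuclideanSpace ℝ (Fin n) => y i :=
    (EuclideanSpace.proj (𝕜 := ℝ) i : EuclideanSpace ℝ (Fin n) →L[ℝ] ℝ).contDiff.contMDiff
  refine (euclideanPoint_isBase a ha.1).congr (g := ⟨_, hsm⟩) ?_
  filter_upwards [c.isOpen_tgt.mem_nhds ha.2] with y hy
  rw [c.ext_apply _ _ hy, c.coord_inv y hy]
  rfl

variable [T2Space M] [IsManifold (𝓡 n) ∞ M]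

theorem pointOf_coords {p : APoint n M A} (hp : p ∈ c.pointsOver A) :
    c.pointOf (c.coords p) (c.coords_mem_range hp) = p :=
  c.eq_of_coords_eq (c.pointOf_mem_pointsOver _ _) hp (c.coords_pointOf _ _)

end LocalCoord

end Coordinates

/-! ### Smooth structures generated by real functions -/

section Generated

/-- The topology of `X` is generated by the functions that generate its smooth structure. -/
def IsGenerated (X : Type*) [t : TopologicalSpace X] [SmoothGen X] : Prop :=
  t = SmoothGen.topology X

variable {X Y : Type*} [TopologicalSpace X] [SmoothGen X] [TopologicalSpace Y] [SmoothGen Y]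

theorem IsGenerated.continuousAt_iff {Z : Type*} [TopologicalSpace Z] (hY : IsGenerated Y)
    {g : Z → Y} {z : Z} :
    ContinuousAt g z ↔ ∀ h ∈ SmoothGen.gens (X := Y), ContinuousAt (fun y => h (g y)) z := by
  rw [ContinuousAt, hY]
  simp only [nhds_iInf, Filter.tendsto_iInf, nhds_induced,
    Filter.tendsto_comap_iff]
  rfl

theorem IsGenerated.continuous (hX : IsGenerated X) {h : X → ℝ}
    (hh : h ∈ SmoothGen.gens (X := X)) : Continuous h :=
  continuous_iff_continuousAt.2 fun _ => (hX.continuousAt_iff (g := id)).1 continuousAt_id h hh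

theorem isGenerated_of (hc : ∀ h ∈ SmoothGen.gens (X := X), Continuous h)
    (hle : SmoothGen.topology X ≤ ‹TopologicalSpace X›) : IsGenerated X :=
  le_antisymm (le_iInf₂ fun h hh => continuous_iff_le_induced.1 (hc h hh)) hle

theorem isGenerated_euclideanSpace (d : ℕ) : IsGenerated (EuclideanSpace ℝ (Fin d)) := by
  refine isGenerated_of ?_ ?_
  · rintro _ ⟨i, rfl⟩
    exact (EuclideanSpace.proj (𝕜 := ℝ) i : EuclideanSpace ℝ (Fin d) →L[ℝ] ℝ).continuous
  · let _ : TopologicalSpace (EuclideanSpace ℝ (Fin d)) := SmoothGen.topology _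
    have h1 : Continuous fun (x : EuclideanSpace ℝ (Fin d)) (i : Fin d) => x i :=
      continuous_pi fun i => continuous_iff_le_induced.2 (iInf₂_le _ ⟨i, rfl⟩)
    exact continuous_iff_le_induced.1 h1

theorem IsGenerated.prod (hX : IsGenerated X) (hY : IsGenerated Y) : IsGenerated (X × Y) := by
  refine isGenerated_of ?_ ?_
  · rintro _ (⟨h, hh, rfl⟩ | ⟨h, hh, rfl⟩)
    · exact (hX.continuous hh).comp continuous_fst
    · exact (hY.continuous hh).comp continuous_snd
  · have hgen : ∀ h ∈ SmoothGen.gens (X := X × Y), Continuous[SmoothGen.topology (X × Y), _] h :=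
      fun h hh => continuous_iff_le_induced.2 (iInf₂_le _ hh)
    refine le_inf (continuous_iff_le_induced.1 ?_) (continuous_iff_le_induced.1 ?_)
    · let _ : TopologicalSpace (X × Y) := SmoothGen.topology _
      exact continuous_iff_continuousAt.2 fun z => hX.continuousAt_iff.2 fun h hh =>
        (hgen _ (Or.inl ⟨h, hh, rfl⟩)).continuousAt
    · let _ : TopologicalSpace (X × Y) := SmoothGen.topology _
      exact continuous_iff_continuousAt.2 fun z => hY.continuousAt_iff.2 fun h hh =>
        (hgen _ (Or.inr ⟨h, hh, rfl⟩)).continuousAt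

theorem smoothAt_of_mem_gens {h : X → ℝ} (hh : h ∈ SmoothGen.gens (X := X)) (x : X) :
    SmoothAt h x :=
  ⟨1, fun _ => h, fun v => v 0, fun _ => hh, contDiff_apply ℝ ℝ 0, Filter.Eventually.of_forall
    fun _ => rfl⟩

theorem SmoothAt.congr {F G : X → ℝ} {x : X} (hF : SmoothAt F x) (h : ∀ᶠ y in 𝓝 x, G y = F y) :
    SmoothAt G x := by
  obtain ⟨k, g, w, hg, hw, hF⟩ := hF
  exact ⟨k, g, w, hg, hw, by filter_upwards [h, hF] with y h1 h2 using h1.trans h2⟩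

theorem SmoothAt.continuousAt (hX : IsGenerated X) {F : X → ℝ} {x : X} (hF : SmoothAt F x) :
    ContinuousAt F x := by
  obtain ⟨k, h, w, hh, hw, hF⟩ := hF
  refine ContinuousAt.congr ?_ (hF.mono fun y hy => hy.symm)
  exact (hw.continuous.comp (continuous_pi fun i => hX.continuous (hh i))).continuousAt

/-- Since the generators determine the topology, a chart or trivialization needs no separate proof
of continuity. -/
theorem SmoothMapOn.continuousOn (hX : IsGenerated X) (hY : IsGenerated Y) {g : X → Y} {U : Set X}
    (hg : SmoothMapOn g U) : ContinuousOn g U := fun x hx =>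
  (hY.continuousAt_iff.2 fun h hh => (hg x hx h hh).continuousAt hX).continuousWithinAt

/-- A bijection between open sets that is smooth in both directions. -/
def openPartialHomeomorphOfSmooth (hX : IsGenerated X) (hY : IsGenerated Y) (e : PartialEquiv X Y)
    (hs : IsOpen e.source) (ht : IsOpen e.target) (he : SmoothMapOn e e.source)
    (he' : SmoothMapOn e.symm e.target) : OpenPartialHomeomorph X Y where
  toPartialEquiv := e
  open_source := hs
  open_target := ht
  continuousOn_toFun := he.continuousOn hX hY
  continuousOn_invFun := he'.continuousOn hY hX

theorem isDiffeo_openPartialHomeomorphOfSmooth (hX : IsGenerated X) (hY : IsGenerated Y)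
    (e : PartialEquiv X Y) (hs : IsOpen e.source) (ht : IsOpen e.target)
    (he : SmoothMapOn e e.source) (he' : SmoothMapOn e.symm e.target) :
    IsDiffeo (openPartialHomeomorphOfSmooth hX hY e hs ht he he') :=
  ⟨he, he'⟩

/-- The finite lists of generators used by the `F i` are concatenated into one list, indexed by a
sigma type. -/
theorem SmoothAt.comp_contDiff {ι : Type*} [Fintype ι] {F : ι → X → ℝ} {x : X}
    (hF : ∀ i, SmoothAt (F i) x) {w : (ι → ℝ) → ℝ} (hw : ContDiff ℝ ∞ w) :
    SmoothAt (fun y => w fun i => F i y) x := by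
  choose k h v hh hv he using hF
  let e := Fintype.equivFin (Σ i, Fin (k i))
  refine ⟨Fintype.card (Σ i, Fin (k i)), fun j => h (e.symm j).1 (e.symm j).2,
    fun z => w fun i => v i fun j => z (e ⟨i, j⟩), fun j => hh _ _, ?_, ?_⟩
  · exact hw.comp (contDiff_pi.2 fun i => (hv i).comp (contDiff_pi.2 fun j =>
      contDiff_apply ℝ ℝ _))
  · filter_upwards [Filter.eventually_all.2 he] with y hy
    refine congrArg w (funext fun i => ?_)
    rw [hy i]
    refine congrArg (v i) (funext fun j => ?_)
    rw [Equiv.symm_apply_apply]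

section Vector

variable {V W : Type*} [NormedAddCommGroup V] [NormedSpace ℝ V] [NormedAddCommGroup W]
  [NormedSpace ℝ W]

/-- A vector valued function is smooth at a point if its composites with linear forms are. -/
def SmoothVecAt (F : X → V) (x : X) : Prop :=
  ∀ l : V →ₗ[ℝ] ℝ, SmoothAt (fun y => l (F y)) x

theorem SmoothVecAt.contDiff_comp [FiniteDimensional ℝ V] {F : X → V} {x : X}
    (hF : SmoothVecAt F x) {w : V → ℝ} (hw : ContDiff ℝ ∞ w) : SmoothAt (fun y => w (F y)) x := by
  let b := (Module.finBasis ℝ V).equivFunL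
  have := SmoothAt.comp_contDiff (F := fun i y => b (F y) i)
    (fun i => hF ((LinearMap.proj i).comp b.toLinearMap)) (w := fun z => w (b.symm z))
    (hw.comp b.symm.contDiff)
  simpa using this

theorem SmoothVecAt.comp [FiniteDimensional ℝ V] [FiniteDimensional ℝ W] {F : X → V} {x : X}
    (hF : SmoothVecAt F x) {w : V → W} (hw : ContDiff ℝ ∞ w) : SmoothVecAt (fun y => w (F y)) x :=
  fun l => hF.contDiff_comp ((LinearMap.toContinuousLinearMap l).contDiff.comp hw)

theorem SmoothVecAt.comp_linear {F : X → V} {x : X} (hF : SmoothVecAt F x) (w : V →ₗ[ℝ] W) :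
    SmoothVecAt (fun y => w (F y)) x :=
  fun l => hF (l.comp w)

theorem SmoothVecAt.add {F G : X → V} {x : X} (hF : SmoothVecAt F x) (hG : SmoothVecAt G x) :
    SmoothVecAt (fun y => F y + G y) x := fun l => by
  have := SmoothAt.comp_contDiff (F := fun (i : Bool) y => l (cond i (F y) (G y)))
    (fun i => by cases i; exacts [hG l, hF l]) (w := fun z => z true + z false)
    ((contDiff_apply ℝ ℝ true).add (contDiff_apply ℝ ℝ false))
  simpa using this

theorem SmoothVecAt.sub {F G : X → V} {x : X} (hF : SmoothVecAt F x) (hG : SmoothVecAt G x) :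
    SmoothVecAt (fun y => F y - G y) x := by
  simpa [sub_eq_add_neg] using hF.add (hG.comp_linear (-LinearMap.id))

theorem SmoothVecAt.congr {F G : X → V} {x : X} (hF : SmoothVecAt F x)
    (h : ∀ᶠ y in 𝓝 x, G y = F y) : SmoothVecAt G x := fun l =>
  (hF l).congr (h.mono fun y hy => by rw [hy])

theorem smoothVecAt_pi {ι : Type*} [Fintype ι] {F : X → ι → V} {x : X}
    (hF : ∀ i, SmoothVecAt (fun y => F y i) x) : SmoothVecAt F x := fun l => by
  classical
  have := SmoothAt.comp_contDiff (F := fun i y => l (Pi.single i (F y i)))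
    (fun i => hF i (l.comp (LinearMap.single ℝ (fun _ => V) i))) (w := fun z => ∑ i, z i)
    (ContDiff.sum fun i _ => contDiff_apply ℝ ℝ i)
  refine this.congr (Filter.Eventually.of_forall fun y => ?_)
  rw [← map_sum, Finset.univ_sum_single]

theorem smoothVecAt_id_euclideanSpace {d : ℕ} (x : EuclideanSpace ℝ (Fin d)) :
    SmoothVecAt (fun y : EuclideanSpace ℝ (Fin d) => y) x := by
  have h1 : SmoothVecAt (fun (y : EuclideanSpace ℝ (Fin d)) (i : Fin d) => y i) x := by
    refine smoothVecAt_pi fun i l => ?_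
    have := SmoothAt.comp_contDiff (ι := Unit) (x := x)
      (F := fun _ (y : EuclideanSpace ℝ (Fin d)) => y i)
      (fun _ => smoothAt_of_mem_gens (Set.mem_range_self i) x) (w := fun z => l (z ()))
      ((LinearMap.toContinuousLinearMap l).contDiff.comp (contDiff_apply ℝ ℝ ()))
    exact this
  exact h1.comp_linear (WithLp.linearEquiv 2 ℝ (Fin d → ℝ)).symm.toLinearMap

theorem SmoothVecAt.fst {F : X → V} {z : X × Y} (hF : SmoothVecAt F z.1) :
    SmoothVecAt (fun z : X × Y => F z.1) z := fun l => by
  obtain ⟨k, h, w, hh, hw, he⟩ := hF l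
  exact ⟨k, fun i z => h i z.1, w, fun i => Or.inl ⟨h i, hh i, rfl⟩, hw,
    (continuous_fst.tendsto z).eventually he⟩

theorem SmoothVecAt.snd {F : Y → V} {z : X × Y} (hF : SmoothVecAt F z.2) :
    SmoothVecAt (fun z : X × Y => F z.2) z := fun l => by
  obtain ⟨k, h, w, hh, hw, he⟩ := hF l
  exact ⟨k, fun i z => h i z.2, w, fun i => Or.inr ⟨h i, hh i, rfl⟩, hw,
    (continuous_snd.tendsto z).eventually he⟩

theorem SmoothVecAt.coord {d : ℕ} {F : X → EuclideanSpace ℝ (Fin d)} {x : X}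
    (hF : SmoothVecAt F x) {h : EuclideanSpace ℝ (Fin d) → ℝ}
    (hh : h ∈ SmoothGen.gens (X := EuclideanSpace ℝ (Fin d))) :
    SmoothAt (fun y => h (F y)) x := by
  obtain ⟨i, rfl⟩ := hh
  exact hF (EuclideanSpace.proj (𝕜 := ℝ) i : EuclideanSpace ℝ (Fin d) →L[ℝ] ℝ).toLinearMap

end Vector

end Generated

/-! ### The manifold of `A`-points -/

section PointManifold

open IsLocalRing

variable {n : ℕ} {M : Type*} [TopologicalSpace M] [ChartedSpace (EuclideanSpace ℝ (Fin n)) M]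

theorem isGenerated_aPoint (A : Type*) [CommRing A] [Algebra ℝ A] :
    IsGenerated (APoint n M A) := rfl

theorem isGenerated_modelBundle {A B : Type*} [CommRing A] [Algebra ℝ A] [CommRing B] [Algebra ℝ B]
    (φ : A →ₐ[ℝ] B) : IsGenerated (ModelBundle n M φ) := rfl

theorem continuous_lin {A : Type*} [CommRing A] [Algebra ℝ A] (f : SmoothFun n M) (l : A →ₗ[ℝ] ℝ) :
    Continuous fun p : APoint n M A => l (p.lin f) :=
  (isGenerated_aPoint A).continuous ⟨f, l, rfl⟩

instance [Nonempty M] (A : Type*) [CommRing A] [Algebra ℝ A] : Nonempty (APoint n M A) :=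
  ⟨((Algebra.ofId ℝ A).comp ((Pi.evalAlgHom ℝ (fun _ : M => ℝ) (Classical.arbitrary M)).comp
    ContMDiffMap.coeFnAlgHom) : SmoothFun n M →ₐ[ℝ] A)⟩

instance (A : Type*) [CommRing A] [Algebra ℝ A] : T2Space (APoint n M A) := by
  refine ⟨fun p p' hne => ?_⟩
  obtain ⟨f, hf⟩ : ∃ f, p.lin f ≠ p'.lin f := by
    by_contra! h; exact hne (APoint.ext_lin h)
  obtain ⟨l, hl⟩ : ∃ l : A →ₗ[ℝ] ℝ, l (p.lin f) ≠ l (p'.lin f) := by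
    by_contra! h
    exact hf (sub_eq_zero.1 ((Module.forall_dual_apply_eq_zero_iff ℝ _).1 fun l => by
      rw [map_sub, h l, sub_self]))
  exact separated_by_continuous (continuous_lin f l) hl

section

variable {A : Type*} [CommRing A] [Algebra ℝ A] [IsLocalRing A] [Module.Finite ℝ A]
variable [T2Space M] [IsManifold (𝓡 n) ∞ M] [SecondCountableTopology M]

/-- For a bump function `χ` in `U`, the real part of `p χ` is the value of `χ` at the base point. It
is continuous in `p`, and being positive it forces the base point into `U`. -/
theorem isOpen_setOf_base (U : Set M) (hU : IsOpen U) :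
    IsOpen {p : APoint n M A | ∃ x ∈ U, p.IsBase x} := by
  refine isOpen_iff_mem_nhds.2 fun p hp => ?_
  obtain ⟨x, hx, hp⟩ := hp
  obtain ⟨χ, h1, h0⟩ := exists_bump (n := n) x (hU.mem_nhds hx)
  have hlt : (1 / 2 : ℝ) < realPart A (p.lin χ) := by rw [hp.realPart_lin, h1]; norm_num
  filter_upwards [(continuous_lin χ (realPart A)).continuousAt.eventually (lt_mem_nhds hlt)]
    with p' hp'
  obtain ⟨x', hx'⟩ := p'.exists_isBase
  refine ⟨x', ?_, hx'⟩
  by_contra h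
  rw [hx'.realPart_lin, h0 x' h] at hp'
  norm_num at hp'

theorem LocalCoord.isOpen_pointsOver (c : LocalCoord n M) : IsOpen (c.pointsOver A) :=
  isOpen_setOf_base c.dom c.isOpen_dom

end

section

variable {A : Type*} [NormedCommRing A] [NormedAlgebra ℝ A]

theorem smoothVecAt_lin (f : SmoothFun n M) (p : APoint n M A) :
    SmoothVecAt (fun p : APoint n M A => p.lin f) p :=
  fun l => smoothAt_of_mem_gens (by exact ⟨f, l, rfl⟩) p

theorem LocalCoord.smoothVecAt_coords (c : LocalCoord n M) (p : APoint n M A) :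
    SmoothVecAt (fun p : APoint n M A => c.coords p) p :=
  smoothVecAt_pi fun _ => smoothVecAt_lin _ p

variable [IsLocalRing A]

theorem continuous_realPoint [Module.Finite ℝ A] :
    Continuous (realPoint : (Fin n → A) → EuclideanSpace ℝ (Fin n)) :=
  (PiLp.continuous_toLp 2 _).comp (continuous_pi fun i =>
    (LinearMap.continuous_of_finiteDimensional (realPart A)).comp (continuous_apply i))

variable (A) in
/-- The elements that differ from a real number by an element of the maximal ideal. -/
def nearReal : Submodule ℝ A :=
  ((maximalIdeal A).restrictScalars ℝ).comap
    (LinearMap.id - (Algebra.linearMap ℝ A).comp (realPart A))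

namespace LocalCoord

variable (c : LocalCoord n M) [Nonempty M] [Module.Finite ℝ A]

open Classical in
/-- The `A`-point with given coordinates, with an arbitrary value for impossible coordinates. -/
def pointAt (a : Fin n → A) : APoint n M A :=
  if h : a ∈ c.range A then c.pointOf a h else Classical.arbitrary _

theorem pointAt_lin {a : Fin n → A} (ha : a ∈ c.range A) (f : SmoothFun n M) :
    (c.pointAt a).lin f = taylorEval (c.ext f) a := by
  rw [pointAt, dif_pos ha, pointOf_lin]

theorem pointAt_mem_pointsOver {a : Fin n → A} (ha : a ∈ c.range A) :
    c.pointAt a ∈ c.pointsOver A := by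
  rw [pointAt, dif_pos ha]; exact c.pointOf_mem_pointsOver a ha

theorem coords_pointAt {a : Fin n → A} (ha : a ∈ c.range A) : c.coords (c.pointAt a) = a := by
  rw [pointAt, dif_pos ha, coords_pointOf]

theorem smoothVecAt_pointAt {X : Type*} [TopologicalSpace X] [SmoothGen X] {a : X → Fin n → A}
    {x : X} (ha : SmoothVecAt a x) (h : ∀ᶠ y in 𝓝 x, a y ∈ c.range A) (f : SmoothFun n M) :
    SmoothVecAt (fun y => (c.pointAt (a y)).lin f) x :=
  (ha.comp (contDiff_taylorEval (SmoothFun.contDiff (c.ext f)))).congr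
    (h.mono fun _ hy => c.pointAt_lin hy f)

variable [T2Space M] [IsManifold (𝓡 n) ∞ M]

theorem pointAt_coords {p : APoint n M A} (hp : p ∈ c.pointsOver A) :
    c.pointAt (c.coords p) = p := by
  rw [pointAt, dif_pos (c.coords_mem_range hp), pointOf_coords c hp]

end LocalCoord

variable [Module.Finite ℝ A] [Nonempty M] [T2Space M] [IsManifold (𝓡 n) ∞ M]
  [SecondCountableTopology M]

/-- Coordinates of points fill an open subset of `(nearReal A)ⁿ`. A linear retraction of `A` onto
`nearReal A` makes the chart a linear function of the coordinates, and Taylor's formula makes its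
inverse smooth. -/
theorem LocalCoord.exists_chart (c : LocalCoord n M) :
    ∃ e : OpenPartialHomeomorph (APoint n M A)
      (EuclideanSpace ℝ (Fin (Module.finrank ℝ (Fin n → nearReal A)))),
      e.source = c.pointsOver A ∧ IsDiffeo e := by
  obtain ⟨P, hP⟩ := (nearReal A).subtype.exists_leftInverse_of_injective
    (Submodule.ker_subtype _)
  have hP' : ∀ a : nearReal A, P a = a := fun a => LinearMap.congr_fun hP a
  let L := toEuclidean (E := Fin n → nearReal A)
  let J : EuclideanSpace ℝ (Fin (Module.finrank ℝ (Fin n → nearReal A))) →ₗ[ℝ] (Fin n → A) :=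
    (LinearMap.compLeft (nearReal A).subtype (Fin n)).comp L.symm.toLinearMap
  let Q : (Fin n → A) →ₗ[ℝ] EuclideanSpace ℝ (Fin (Module.finrank ℝ (Fin n → nearReal A))) :=
    L.toLinearMap.comp (LinearMap.compLeft P (Fin n))
  have hQJ : ∀ z, Q (J z) = z := by
    intro z
    change L (fun i => P (L.symm z i)) = z
    simp only [hP']
    exact L.apply_symm_apply z
  have hJQ : ∀ a : Fin n → A, (∀ i, a i ∈ nearReal A) → J (Q a) = a := by
    intro a ha
    change (fun i => ((L.symm (L fun i => P (a i))) i : A)) = a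
    rw [L.symm_apply_apply]
    ext i
    exact congrArg Subtype.val (hP' ⟨a i, ha i⟩)
  have hJmem : ∀ z i, J z i ∈ nearReal A := fun z i => (L.symm z i).2
  have hJrange : ∀ z, J z ∈ c.range A ↔ realPoint (J z) ∈ c.tgt := fun z =>
    ⟨fun h => h.2, fun h => ⟨hJmem z, h⟩⟩
  let e : PartialEquiv (APoint n M A)
      (EuclideanSpace ℝ (Fin (Module.finrank ℝ (Fin n → nearReal A)))) :=
    { toFun := fun p => Q (c.coords p)
      invFun := fun z => c.pointAt (J z)
      source := c.pointsOver A
      target := {z | J z ∈ c.range A}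
      map_source' := fun p hp => by
        have := c.coords_mem_range hp
        change J (Q (c.coords p)) ∈ c.range A
        rwa [hJQ (c.coords p) this.1]
      map_target' := fun z hz => c.pointAt_mem_pointsOver hz
      left_inv' := fun p hp => by
        rw [hJQ (c.coords p) (c.coords_mem_range hp).1, c.pointAt_coords hp]
      right_inv' := fun z hz => by rw [c.coords_pointAt hz, hQJ] }
  have htarget : IsOpen e.target := by
    have : e.target = (fun z => realPoint (J z)) ⁻¹' c.tgt := Set.ext hJrange
    rw [this]
    exact c.isOpen_tgt.preimage
      (continuous_realPoint.comp (LinearMap.continuous_of_finiteDimensional J))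
  have h1 : SmoothMapOn e e.source := fun p _ h hh =>
    ((c.smoothVecAt_coords p).comp_linear Q).coord hh
  have h2 : SmoothMapOn e.symm e.target := by
    rintro z hz _ ⟨f, l, rfl⟩
    exact c.smoothVecAt_pointAt ((smoothVecAt_id_euclideanSpace z).comp_linear J)
      (htarget.mem_nhds hz) f l
  exact ⟨openPartialHomeomorphOfSmooth (isGenerated_aPoint A) (isGenerated_euclideanSpace _) e
    c.isOpen_pointsOver htarget h1 h2, rfl, h1, h2⟩

variable (n M A) in
theorem isSmoothManifold_aPoint : IsSmoothManifold (APoint n M A) := by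
  choose c hc using fun x : M => exists_localCoord (n := n) x
  choose e hes hed using fun x => (c x).exists_chart (A := A)
  refine ⟨inferInstance, ?_, Module.finrank ℝ (Fin n → nearReal A), fun p => ?_⟩
  -- Countably many coordinate domains cover `M`; every point has a base point, so the charts over
  -- them cover `M^A`.
  · obtain ⟨s, hs, hcov⟩ := TopologicalSpace.countable_cover_nhds fun x =>
      (c x).isOpen_dom.mem_nhds (hc x)
    have : Countable s := hs.to_subtype
    have hsc : ∀ x : s, SecondCountableTopology (e x).source := fun x =>
      (e x).secondCountableTopology_source
    refine TopologicalSpace.secondCountableTopology_of_countable_cover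
      (U := fun x : s => (e x).source) (fun x => (e x).open_source) ?_
    refine Set.eq_univ_of_forall fun p => ?_
    obtain ⟨y, hy⟩ := p.exists_isBase
    obtain ⟨x, hx, hyx⟩ := Set.mem_iUnion₂.1 (hcov.symm ▸ Set.mem_univ y)
    exact Set.mem_iUnion.2 ⟨⟨x, hx⟩, (hes x).symm ▸ ⟨y, hyx, hy⟩⟩
  · obtain ⟨y, hy⟩ := p.exists_isBase
    exact ⟨e y, (hes y).symm ▸ ⟨y, hc y, hy⟩, hed y⟩

end

end PointManifold

/-! ### Kernels of square zero -/

section SquareZero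

variable {n : ℕ} {M : Type*} [TopologicalSpace M] [ChartedSpace (EuclideanSpace ℝ (Fin n)) M]
  {A B : Type*} [CommRing A] [Algebra ℝ A] [CommRing B] [Algebra ℝ B] {φ : A →ₐ[ℝ] B}

theorem mul_eq_zero_of_mem_ker (hI : RingHom.ker φ ^ 2 = ⊥) {a b : A} (ha : φ a = 0)
    (hb : φ b = 0) : a * b = 0 := by
  have : a * b ∈ RingHom.ker φ ^ 2 := by
    rw [sq]; exact Ideal.mul_mem_mul ha hb
  rwa [hI] at this

theorem map_sub_eq_zero {p p' : APoint n M A} (h : natTrans φ p = natTrans φ p')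
    (f : SmoothFun n M) : φ (p.lin f - p'.lin f) = 0 := by
  rw [map_sub, sub_eq_zero, ← natTrans_lin, h, natTrans_lin]

/-- The two Leibniz rules differ by products of a value of `p - p'` and a value of `D`, both in the
kernel. -/
theorem verticalSpace_le (hI : RingHom.ker φ ^ 2 = ⊥) {p p' : APoint n M A}
    (h : natTrans φ p = natTrans φ p') : verticalSpace φ p ≤ verticalSpace φ p' := by
  rintro D ⟨h1, h2⟩
  refine ⟨fun f g => ?_, h2⟩
  have hz : ∀ f g, (p.lin f - p'.lin f) * D g = 0 := fun f g =>
    mul_eq_zero_of_mem_ker hI (map_sub_eq_zero h f) (h2 g)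
  rw [h1]
  linear_combination hz f g + hz g f

theorem mem_modelFibre {q : APoint n M B} {D : SmoothFun n M →ₗ[ℝ] A} :
    D ∈ modelFibre φ q ↔ ∀ p : APoint n M A, natTrans φ p = q → D ∈ verticalSpace φ p := by
  simp only [modelFibre, Submodule.mem_iInf]

theorem verticalSpace_eq_modelFibre (hI : RingHom.ker φ ^ 2 = ⊥) (p : APoint n M A) :
    verticalSpace φ p = modelFibre φ (natTrans φ p) := by
  ext D
  rw [mem_modelFibre]
  exact ⟨fun hD p' hp' => verticalSpace_le hI hp'.symm hD, fun h => h p rfl⟩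

theorem sub_mem_modelFibre (hI : RingHom.ker φ ^ 2 = ⊥) {p p' : APoint n M A}
    (h : natTrans φ p = natTrans φ p') : p'.lin - p.lin ∈ modelFibre φ (natTrans φ p) := by
  rw [← verticalSpace_eq_modelFibre hI]
  refine ⟨fun f g => ?_, map_sub_eq_zero h.symm⟩
  have hz := mul_eq_zero_of_mem_ker hI (map_sub_eq_zero h.symm f) (map_sub_eq_zero h.symm g)
  simp only [LinearMap.sub_apply, APoint.lin_mul]
  linear_combination hz

/-- The only obstruction to multiplicativity of `p + D` is `D f * D g`, which lies in the square of
the kernel. -/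
theorem exists_lin_eq_add (hI : RingHom.ker φ ^ 2 = ⊥) {p : APoint n M A}
    {D : SmoothFun n M →ₗ[ℝ] A} (hD : D ∈ modelFibre φ (natTrans φ p)) :
    ∃ p' : APoint n M A, natTrans φ p' = natTrans φ p ∧ p'.lin = p.lin + D := by
  rw [← verticalSpace_eq_modelFibre hI] at hD
  obtain ⟨h1, h2⟩ := hD
  have hD1 : D 1 = 0 := by
    have := h1 1 1
    rw [mul_one, p.lin_one, one_mul] at this
    simpa using this
  refine ⟨APoint.ofLin (p.lin + D) (by simp [hD1, p.lin_one]) fun f g => ?_, ?_, rfl⟩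
  · have hz := mul_eq_zero_of_mem_ker hI (h2 f) (h2 g)
    simp only [LinearMap.add_apply, APoint.lin_mul, h1]
    linear_combination -hz
  · refine APoint.ext_lin fun f => ?_
    have : φ (D f) = 0 := h2 f
    simp [this]

end SquareZero

/-! ### Lifting points along `φ`, and necessity of `I² = 0` -/

section Converse

open IsLocalRing

variable {n : ℕ} {M : Type*} [TopologicalSpace M] [ChartedSpace (EuclideanSpace ℝ (Fin n)) M]
  {A B : Type*} [NormedCommRing A] [NormedAlgebra ℝ A] [NormedCommRing B] [NormedAlgebra ℝ B]
  {φ : A →ₐ[ℝ] B}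

theorem coords_natTrans (c : LocalCoord n M) (p : APoint n M A) (i : Fin n) :
    c.coords (natTrans φ p) i = φ (c.coords p i) := rfl

variable [IsLocalRing A] [IsLocalRing B]

/-- A surjection of local rings reflects the maximal ideal, so every lift of the coordinates has the
same real parts and is itself a tuple of coordinates. -/
theorem LocalCoord.mem_range_of_map (hφ : Function.Surjective φ) {c : LocalCoord n M}
    {q : APoint n M B} (hq : q ∈ c.pointsOver B) {a : Fin n → A}
    (ha : ∀ i, φ (a i) = c.coords q i) : a ∈ c.range A := by
  obtain ⟨x, hx, hqx⟩ := hq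
  have hm : ∀ i, a i - algebraMap ℝ A (c.coord i x) ∈ maximalIdeal A := fun i => by
    rw [← map_mem_maximalIdeal_iff hφ, map_sub, ha, AlgHom.commutes]
    exact hqx _
  have hr : ∀ i, realPart A (a i) = c.coord i x := fun i => realPart_eq (hm i)
  refine ⟨fun i => (hr i).symm ▸ hm i, ?_⟩
  simp only [realPoint, hr]
  exact c.chart_mem x hx

theorem natTrans_mem_pointsOver (hφ : Function.Surjective φ) {c : LocalCoord n M}
    {p : APoint n M A} (hp : p ∈ c.pointsOver A) : natTrans φ p ∈ c.pointsOver B := by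
  obtain ⟨x, hx, hpx⟩ := hp
  exact ⟨x, hx, hpx.natTrans hφ⟩

variable [IsManifold (𝓡 n) ∞ M] [T2Space M] [Module.Finite ℝ A]

theorem natTrans_mem_pointsOver_iff [SecondCountableTopology M] (hφ : Function.Surjective φ)
    {c : LocalCoord n M} {p : APoint n M A} :
    natTrans φ p ∈ c.pointsOver B ↔ p ∈ c.pointsOver A := by
  refine ⟨?_, natTrans_mem_pointsOver hφ⟩
  rintro ⟨x, hx, hqx⟩
  obtain ⟨y, hy⟩ := p.exists_isBase
  exact ⟨y, (hy.natTrans hφ).unique hqx ▸ hx, hy⟩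

variable [Module.Finite ℝ B]

theorem natTrans_pointAt [Nonempty M] (hφ : Function.Surjective φ) {c : LocalCoord n M}
    {q : APoint n M B} (hq : q ∈ c.pointsOver B) {a : Fin n → A}
    (ha : ∀ i, φ (a i) = c.coords q i) : natTrans φ (c.pointAt a) = q := by
  have hr := LocalCoord.mem_range_of_map hφ hq ha
  refine c.eq_of_coords_eq (natTrans_mem_pointsOver hφ (c.pointAt_mem_pointsOver hr)) hq ?_
  ext i
  rw [coords_natTrans, c.coords_pointAt hr, ha]

variable (n M) in
theorem ker_sq_eq_bot_of_sub_mem [Nonempty M] (hφ : Function.Surjective φ) (hn : 0 < n)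
    (h : ∀ p p' : APoint n M A, natTrans φ p = natTrans φ p' →
      p'.lin - p.lin ∈ modelFibre φ (natTrans φ p)) : RingHom.ker φ ^ 2 = ⊥ := by
  obtain ⟨c, hc⟩ := exists_localCoord (n := n) (Classical.arbitrary M)
  set x := Classical.arbitrary M
  have hsq : ∀ a ∈ RingHom.ker φ, a * a = 0 := by
    intro a ha
    have ha : φ a = 0 := ha
    let i₀ : Fin n := ⟨0, hn⟩
    let a₀ : Fin n → A := fun i => algebraMap ℝ A (c.coord i x)
    let a₁ : Fin n → A := a₀ + Pi.single i₀ a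
    let b₀ : Fin n → B := fun i => algebraMap ℝ B (c.coord i x)
    have hb₀ : b₀ ∈ c.range B := by
      refine ⟨fun i => by simp [b₀], ?_⟩
      simp only [b₀, realPoint, realPart_algebraMap]
      exact c.chart_mem x hc
    have hq := c.pointAt_mem_pointsOver hb₀
    have h0 : ∀ i, φ (a₀ i) = c.coords (c.pointAt b₀) i := fun i => by
      rw [c.coords_pointAt hb₀]; exact φ.commutes _
    have h1 : ∀ i, φ (a₁ i) = c.coords (c.pointAt b₀) i := fun i => by
      rw [← h0]
      by_cases hi : i = i₀ <;> simp [a₁, hi, ha]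
    have hD := h (c.pointAt a₀) (c.pointAt a₁)
      ((natTrans_pointAt hφ hq h0).trans (natTrans_pointAt hφ hq h1).symm)
    -- With `t` the real value of the coordinate, the Leibniz rule reads `(t + a)² - t² = 2 t a`.
    have hL := (mem_modelFibre.1 hD _ rfl).1 (c.coord i₀) (c.coord i₀)
    have e0 : (c.pointAt a₀).lin (c.coord i₀) = a₀ i₀ :=
      congrFun (c.coords_pointAt (LocalCoord.mem_range_of_map hφ hq h0)) i₀
    have e1 : (c.pointAt a₁).lin (c.coord i₀) = a₀ i₀ + a := by
      have := congrFun (c.coords_pointAt (LocalCoord.mem_range_of_map hφ hq h1)) i₀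
      refine Eq.trans this ?_
      simp [a₁]
    simp only [LinearMap.sub_apply, APoint.lin_mul, e0, e1] at hL
    linear_combination hL
  rw [sq, eq_bot_iff, Ideal.mul_le]
  intro a ha b hb
  -- Polarization of `a * a = 0`.
  have h2 : (2 : ℝ) • (a * b) = 0 := by
    rw [two_smul]
    linear_combination hsq _ (add_mem ha hb) - hsq _ ha - hsq _ hb
  exact (smul_eq_zero.1 h2).resolve_left two_ne_zero

end Converse

/-! ### Local trivializations -/

section Trivializations

variable {n : ℕ} {M : Type*} [TopologicalSpace M] [ChartedSpace (EuclideanSpace ℝ (Fin n)) M]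
  {A B : Type*} [NormedCommRing A] [NormedAlgebra ℝ A] [NormedCommRing B] [NormedAlgebra ℝ B]
  {φ : A →ₐ[ℝ] B}

/-- A linear section of `φ`, together with coordinates on the tuples of elements of the kernel. -/
structure KernelCoord (n r : ℕ) (φ : A →ₐ[ℝ] B) where
  sec : (Fin n → B) →ₗ[ℝ] (Fin n → A)
  toVec : (Fin n → A) →ₗ[ℝ] EuclideanSpace ℝ (Fin r)
  ofVec : EuclideanSpace ℝ (Fin r) →ₗ[ℝ] (Fin n → A)
  map_sec : ∀ b i, φ (sec b i) = b i
  map_ofVec : ∀ v i, φ (ofVec v i) = 0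
  toVec_sec : ∀ b, toVec (sec b) = 0
  toVec_ofVec : ∀ v, toVec (ofVec v) = v
  ofVec_toVec : ∀ a, ofVec (toVec a) = a - sec fun i => φ (a i)

variable (n) in
-- For a linear section `τ` of `φ`, the map `id - τ ∘ φ` projects onto the kernel. The rank `r` is
-- `n` times the dimension of the kernel.
theorem exists_kernelCoord [Module.Finite ℝ A] (hφ : Function.Surjective φ) : ∃ r, Nonempty (KernelCoord n r φ) := by
  obtain ⟨τ, hτ⟩ := φ.toLinearMap.exists_rightInverse_of_surjective (LinearMap.range_eq_top.2 hφ)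
  have hτ' : ∀ b, φ (τ b) = b := fun b => LinearMap.congr_fun hτ b
  let N := LinearMap.ker φ.toLinearMap
  let κ : A →ₗ[ℝ] N := (LinearMap.id - τ.comp φ.toLinearMap).codRestrict N fun a => by
    change φ (a - τ (φ a)) = 0
    rw [map_sub, hτ', sub_self]
  have hκ : ∀ a, (κ a : A) = a - τ (φ a) := fun a => rfl
  let L := toEuclidean (E := Fin n → N)
  refine ⟨_, ⟨{
    sec := LinearMap.compLeft τ (Fin n)
    toVec := L.toLinearMap.comp (LinearMap.compLeft κ (Fin n))
    ofVec := (LinearMap.compLeft N.subtype (Fin n)).comp L.symm.toLinearMap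
    map_sec := fun b i => hτ' _
    map_ofVec := fun v i => (L.symm v i).2
    toVec_sec := fun b => ?_
    toVec_ofVec := fun v => ?_
    ofVec_toVec := fun a => ?_ }⟩⟩
  · change L (fun i => κ (τ (b i))) = 0
    rw [← map_zero L]
    congr 1
    ext i
    rw [hκ, hτ', sub_self]
    rfl
  · change L (fun i => κ (L.symm v i : A)) = v
    refine Eq.trans ?_ (L.apply_symm_apply v)
    congr 1
    ext i
    have : φ (L.symm v i : A) = 0 := (L.symm v i).2
    rw [hκ, this, map_zero, sub_zero]
  · change (fun i => ((L.symm (L fun i => κ (a i))) i : A)) = _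
    rw [L.symm_apply_apply]
    rfl

variable {r : ℕ} (K : KernelCoord n r φ) (c : LocalCoord n M)

theorem KernelCoord.map_add_sec (b : Fin n → B) (v : EuclideanSpace ℝ (Fin r)) (i : Fin n) :
    φ ((K.sec b + K.ofVec v) i) = b i := by
  rw [Pi.add_apply, map_add, K.map_sec, K.map_ofVec, add_zero]

theorem smoothVecAt_sec_add_ofVec (z : APoint n M B × EuclideanSpace ℝ (Fin r)) :
    SmoothVecAt (fun z : APoint n M B × EuclideanSpace ℝ (Fin r) =>
      K.sec (c.coords z.1) + K.ofVec z.2) z :=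
  (SmoothVecAt.comp_linear (SmoothVecAt.fst (c.smoothVecAt_coords z.1)) K.sec).add
    (SmoothVecAt.comp_linear (SmoothVecAt.snd (smoothVecAt_id_euclideanSpace z.2)) K.ofVec)

theorem continuous_modelBundle_proj (φ : A →ₐ[ℝ] B) :
    Continuous (ModelBundle.proj (n := n) (M := M) φ) := by
  refine continuous_iff_continuousAt.2 fun v => (isGenerated_aPoint B).continuousAt_iff.2 ?_
  rintro _ ⟨f, l, rfl⟩
  exact ((isGenerated_modelBundle φ).continuous (Or.inl ⟨f, l, rfl⟩)).continuousAt

variable [Nonempty M] [IsLocalRing A] [Module.Finite ℝ A] [IsLocalRing B]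

/-- The derivation over `q` with given coordinates, as a difference of two points of the fibre. -/
def derivationAux (q : APoint n M B) (v : EuclideanSpace ℝ (Fin r)) : SmoothFun n M →ₗ[ℝ] A :=
  (c.pointAt (K.sec (c.coords q) + K.ofVec v)).lin -
    (c.pointAt (K.sec (c.coords q) + K.ofVec 0)).lin

theorem derivationAux_coord (hφ : Function.Surjective φ) {q : APoint n M B}
    (hq : q ∈ c.pointsOver B) (v : EuclideanSpace ℝ (Fin r)) :
    (fun i => derivationAux K c q v (c.coord i)) = K.ofVec v := by
  have h0 := c.coords_pointAt (LocalCoord.mem_range_of_map hφ hq (K.map_add_sec (c.coords q) 0))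
  have hv := c.coords_pointAt (LocalCoord.mem_range_of_map hφ hq (K.map_add_sec (c.coords q) v))
  refine (congrArg₂ (· - ·) hv h0).trans ?_
  simp only [map_zero, add_zero, add_sub_cancel_left]

variable [IsManifold (𝓡 n) ∞ M] [T2Space M] [Module.Finite ℝ B]

open Classical in
/-- The derivation over `q` with given coordinates. -/
def derivationAt (q : APoint n M B) (v : EuclideanSpace ℝ (Fin r)) : modelFibre φ q :=
  -- The value `0` never occurs over the coordinate domain when the kernel has square zero.
  if h : derivationAux K c q v ∈ modelFibre φ q then ⟨_, h⟩ else 0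

theorem derivationAt_eq (hφ : Function.Surjective φ) (hI : RingHom.ker φ ^ 2 = ⊥)
    {q : APoint n M B} (hq : q ∈ c.pointsOver B) (v : EuclideanSpace ℝ (Fin r)) :
    (derivationAt K c q v).1 = derivationAux K c q v := by
  have h0 := natTrans_pointAt hφ hq (K.map_add_sec (c.coords q) 0)
  have hv := natTrans_pointAt hφ hq (K.map_add_sec (c.coords q) v)
  have := sub_mem_modelFibre hI (h0.trans hv.symm)
  rw [h0] at this
  rw [derivationAt, dif_pos (show derivationAux K c q v ∈ modelFibre φ q from this)]

/-- `modelFibre` is an infimum over the points above `q`, which would be the whole space if there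
were none; a lift of `q` is therefore needed. -/
theorem map_eq_zero_of_mem_modelFibre (K : KernelCoord n r φ)
    (c : LocalCoord n M) (hφ : Function.Surjective φ)
    {q : APoint n M B} (hq : q ∈ c.pointsOver B) {D : SmoothFun n M →ₗ[ℝ] A}
    (hD : D ∈ modelFibre φ q) (f : SmoothFun n M) : φ (D f) = 0 := by
  have hq' := natTrans_pointAt hφ hq (K.map_add_sec (c.coords q) 0)
  exact (mem_modelFibre.1 hD _ hq').2 f

variable [SecondCountableTopology M]

/-- An `A`-point is given by its image and the kernel components of its coordinates. -/
def pointHomeo (hφ : Function.Surjective φ) :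
    OpenPartialHomeomorph (APoint n M A) (APoint n M B × EuclideanSpace ℝ (Fin r)) :=
  openPartialHomeomorphOfSmooth (isGenerated_aPoint A)
    ((isGenerated_aPoint B).prod (isGenerated_euclideanSpace r))
    { toFun := fun p => (natTrans φ p, K.toVec (c.coords p))
      invFun := fun z => c.pointAt (K.sec (c.coords z.1) + K.ofVec z.2)
      source := c.pointsOver A
      target := c.pointsOver B ×ˢ Set.univ
      map_source' := fun p hp => ⟨natTrans_mem_pointsOver hφ hp, trivial⟩
      map_target' := fun z hz => c.pointAt_mem_pointsOver
        (LocalCoord.mem_range_of_map hφ hz.1 (K.map_add_sec _ _))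
      left_inv' := fun p hp => by
        have : K.sec (c.coords (natTrans φ p)) + K.ofVec (K.toVec (c.coords p)) = c.coords p := by
          rw [K.ofVec_toVec]
          exact add_sub_cancel _ _
        simp only [this, c.pointAt_coords hp]
      right_inv' := fun z hz => by
        refine Prod.ext (natTrans_pointAt hφ hz.1 (K.map_add_sec _ _)) ?_
        simp only [c.coords_pointAt (LocalCoord.mem_range_of_map hφ hz.1 (K.map_add_sec _ z.2)),
          map_add, K.toVec_sec, K.toVec_ofVec, zero_add] }
    c.isOpen_pointsOver (c.isOpen_pointsOver.prod isOpen_univ)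
    (by
      rintro p hp _ (⟨_, ⟨f, l, rfl⟩, rfl⟩ | ⟨h, hh, rfl⟩)
      · exact smoothAt_of_mem_gens (by exact ⟨f, l.comp φ.toLinearMap, rfl⟩) p
      · exact ((c.smoothVecAt_coords p).comp_linear K.toVec).coord hh)
    (by
      rintro z hz _ ⟨f, l, rfl⟩
      refine c.smoothVecAt_pointAt (smoothVecAt_sec_add_ofVec K c z) ?_ f l
      filter_upwards [(c.isOpen_pointsOver.prod isOpen_univ).mem_nhds hz] with y hy
      exact LocalCoord.mem_range_of_map hφ hy.1 (K.map_add_sec _ _))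

theorem isDiffeo_pointHomeo (hφ : Function.Surjective φ) :
    IsDiffeo (pointHomeo K c hφ) :=
  isDiffeo_openPartialHomeomorphOfSmooth _ _ _ _ _ _ _

/-- The local trivialization of `M^A → M^B` in coordinates. -/
def pointTrivialization (hφ : Function.Surjective φ) :
    Bundle.Trivialization (EuclideanSpace ℝ (Fin r)) (natTrans (n := n) (M := M) φ) where
  toOpenPartialHomeomorph := pointHomeo K c hφ
  baseSet := c.pointsOver B
  open_baseSet := c.isOpen_pointsOver
  source_eq := Set.ext fun _ => (natTrans_mem_pointsOver_iff hφ).symm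
  target_eq := rfl
  proj_toFun := fun _ _ => rfl

/-- Adding both derivations to one point over `q` reduces the claim to the fact that coordinates
determine points. -/
theorem modelFibre_ext (K : KernelCoord n r φ) (c : LocalCoord n M) (hφ : Function.Surjective φ) (hI : RingHom.ker φ ^ 2 = ⊥)
    {q : APoint n M B} (hq : q ∈ c.pointsOver B) {D D' : SmoothFun n M →ₗ[ℝ] A}
    (hD : D ∈ modelFibre φ q) (hD' : D' ∈ modelFibre φ q)
    (h : ∀ i, D (c.coord i) = D' (c.coord i)) : D = D' := by
  obtain ⟨p, rfl⟩ : ∃ p : APoint n M A, natTrans φ p = q :=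
    ⟨_, natTrans_pointAt hφ hq (K.map_add_sec (c.coords q) 0)⟩
  obtain ⟨p₁, h₁, e₁⟩ := exists_lin_eq_add hI hD
  obtain ⟨p₂, h₂, e₂⟩ := exists_lin_eq_add hI hD'
  have : p₁ = p₂ := by
    refine c.eq_of_coords_eq ((natTrans_mem_pointsOver_iff hφ).1 (h₁.symm ▸ hq))
      ((natTrans_mem_pointsOver_iff hφ).1 (h₂.symm ▸ hq)) ?_
    ext i
    simp only [LocalCoord.coords, e₁, e₂, LinearMap.add_apply, h]
  rw [this, e₂] at e₁
  exact (add_left_cancel e₁).symm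

/-- A derivation is given by its base point and its values on the coordinates. -/
def derivationHomeo (hφ : Function.Surjective φ) (hI : RingHom.ker φ ^ 2 = ⊥) :
    OpenPartialHomeomorph (ModelBundle n M φ) (APoint n M B × EuclideanSpace ℝ (Fin r)) :=
  openPartialHomeomorphOfSmooth (isGenerated_modelBundle φ)
    ((isGenerated_aPoint B).prod (isGenerated_euclideanSpace r))
    { toFun := fun v => (v.1, K.toVec fun i => v.2.1 (c.coord i))
      invFun := fun z => ⟨z.1, derivationAt K c z.1 z.2⟩
      source := ModelBundle.proj φ ⁻¹' c.pointsOver B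
      target := c.pointsOver B ×ˢ Set.univ
      map_source' := fun v hv => ⟨hv, trivial⟩
      map_target' := fun z hz => hz.1
      left_inv' := by
        rintro ⟨q, D⟩ hq
        have hq : q ∈ c.pointsOver B := hq
        refine congrArg (Sigma.mk q) (Subtype.ext ?_)
        refine modelFibre_ext K c hφ hI hq (derivationAt K c q _).2 D.2 fun i => ?_
        rw [derivationAt_eq K c hφ hI hq]
        refine (congrFun (derivationAux_coord K c hφ hq _) i).trans ?_
        rw [K.ofVec_toVec]
        simp only [map_eq_zero_of_mem_modelFibre K c hφ hq D.2]
        have : K.sec (fun _ => 0) = 0 := map_zero K.sec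
        rw [this, sub_zero]
      right_inv' := fun z hz => by
        refine Prod.ext rfl ?_
        simp only [derivationAt_eq K c hφ hI hz.1, derivationAux_coord K c hφ hz.1, K.toVec_ofVec] }
    (c.isOpen_pointsOver.preimage (continuous_modelBundle_proj φ))
    (c.isOpen_pointsOver.prod isOpen_univ)
    (by
      rintro v hv _ (⟨_, ⟨f, l, rfl⟩, rfl⟩ | ⟨h, hh, rfl⟩)
      · exact smoothAt_of_mem_gens (by exact Or.inl ⟨f, l, rfl⟩) v
      · have : SmoothVecAt (fun (v : ModelBundle n M φ) (i : Fin n) => v.2.1 (c.coord i)) v :=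
          smoothVecAt_pi fun i l =>
            smoothAt_of_mem_gens (by exact Or.inr ⟨c.coord i, l, rfl⟩) v
        exact (this.comp_linear K.toVec).coord hh)
    (by
      rintro z hz _ (⟨f, l, rfl⟩ | ⟨f, l, rfl⟩)
      · exact smoothAt_of_mem_gens (by exact Or.inl ⟨_, ⟨f, l, rfl⟩, rfl⟩) z
      -- The derivation is a difference of two families of points, each smooth by Taylor's formula.
      · have hev := (c.isOpen_pointsOver.prod isOpen_univ).mem_nhds hz
        have h1 := c.smoothVecAt_pointAt (smoothVecAt_sec_add_ofVec K c z) (by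
          filter_upwards [hev] with y hy
          exact LocalCoord.mem_range_of_map hφ hy.1 (K.map_add_sec _ _)) f
        have h2 : SmoothVecAt (fun z : APoint n M B × EuclideanSpace ℝ (Fin r) =>
            K.sec (c.coords z.1) + K.ofVec 0) z := by
          simpa using SmoothVecAt.comp_linear (SmoothVecAt.fst (c.smoothVecAt_coords z.1)) K.sec
        have h3 := c.smoothVecAt_pointAt h2 (by
          filter_upwards [hev] with y hy
          exact LocalCoord.mem_range_of_map hφ hy.1 (K.map_add_sec _ _)) f
        refine ((h1.sub h3).congr ?_) l
        filter_upwards [hev] with y hy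
        exact LinearMap.congr_fun (derivationAt_eq K c hφ hI hy.1 y.2) f)

theorem isDiffeo_derivationHomeo (hφ : Function.Surjective φ) (hI : RingHom.ker φ ^ 2 = ⊥) :
    IsDiffeo (derivationHomeo K c hφ hI) :=
  isDiffeo_openPartialHomeomorphOfSmooth _ _ _ _ _ _ _

/-- The local trivialization of the bundle of derivations in coordinates. -/
def derivationTrivialization (hφ : Function.Surjective φ) (hI : RingHom.ker φ ^ 2 = ⊥) :
    Bundle.Trivialization (EuclideanSpace ℝ (Fin r))
      (ModelBundle.proj (n := n) (M := M) φ) where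
  toOpenPartialHomeomorph := derivationHomeo K c hφ hI
  baseSet := c.pointsOver B
  open_baseSet := c.isOpen_pointsOver
  source_eq := rfl
  target_eq := rfl
  proj_toFun := fun _ _ => rfl

variable (n M) in
theorem isAffineBundleByAddition (hφ : Function.Surjective φ) (hI : RingHom.ker φ ^ 2 = ⊥) :
    IsAffineBundleByAddition n M φ where
  total := isSmoothManifold_aPoint n M A
  base := isSmoothManifold_aPoint n M B
  vertical_eq := verticalSpace_eq_modelFibre hI
  add_mem := fun _ _ hD => exists_lin_eq_add hI hD
  sub_mem := fun _ _ h => sub_mem_modelFibre hI h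
  locally_trivial := by
    obtain ⟨r, ⟨K⟩⟩ := exists_kernelCoord n hφ
    refine ⟨r, fun q => ?_⟩
    obtain ⟨x, hx⟩ := q.exists_isBase
    obtain ⟨c, hc⟩ := exists_localCoord (n := n) x
    refine ⟨pointTrivialization K c hφ, derivationTrivialization K c hφ hI, ⟨x, hc, hx⟩, rfl,
      isDiffeo_pointHomeo K c hφ, isDiffeo_derivationHomeo K c hφ hI, fun b _ => ⟨fun D D' => ?_,
        fun a D => ?_⟩, fun p p' _ D h => ?_⟩
    · exact K.toVec.map_add (fun i => D.1 (c.coord i)) fun i => D'.1 (c.coord i)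
    · exact K.toVec.map_smul a fun i => D.1 (c.coord i)
    -- Both trivializations apply the same linear map `K.toVec` to the values on the coordinates.
    · change K.toVec (c.coords p') = K.toVec (c.coords p) + K.toVec fun i => D.1 (c.coord i)
      rw [← map_add]
      congr 1
      ext i
      exact LinearMap.congr_fun h (c.coord i)

end Trivializations

/-- The regular representation is faithful; it serves to pull back the operator norm. -/
theorem exists_injective_algHom (A : Type*) [CommRing A] [Algebra ℝ A] [Module.Finite ℝ A] :
    ∃ (d : ℕ) (f : A →ₐ[ℝ] ((Fin d → ℝ) →L[ℝ] (Fin d → ℝ))), Function.Injective f := by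
  let b := Module.finBasis ℝ A
  refine ⟨_, ((Module.End.toContinuousLinearMap (𝕜 := ℝ) (Fin _ → ℝ)).toAlgHom.comp
    Matrix.toLinAlgEquiv'.toAlgHom).comp (Algebra.leftMulMatrix b), ?_⟩
  exact ((Module.End.toContinuousLinearMap (𝕜 := ℝ) (Fin _ → ℝ)).injective.comp
    Matrix.toLinAlgEquiv'.injective).comp (Algebra.leftMulMatrix_injective b)

end WeilBundle

end

theorem theorem3 (n : ℕ) (M : Type*) [TopologicalSpace M]
    [ChartedSpace (EuclideanSpace ℝ (Fin n)) M] [IsManifold (𝓡 n) ∞ M]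
    [T2Space M] [SecondCountableTopology M] [Nonempty M]
    (A B : Type*) [CommRing A] [Algebra ℝ A] [IsLocalRing A] [Module.Finite ℝ A]
    [CommRing B] [Algebra ℝ B] [IsLocalRing B] [Module.Finite ℝ B]
    (φ : A →ₐ[ℝ] B) (hφ : Function.Surjective φ) :
    (RingHom.ker φ ^ 2 = ⊥ → WeilBundle.IsAffineBundleByAddition n M φ) ∧
      (0 < n → (WeilBundle.IsAffineBundleByAddition n M φ ↔ RingHom.ker φ ^ 2 = ⊥)) := by
  obtain ⟨d, f, hf⟩ := WeilBundle.exists_injective_algHom A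
  obtain ⟨d', f', hf'⟩ := WeilBundle.exists_injective_algHom B
  -- The norms serve only the calculus of `A`-valued functions; the statement does not involve them.
  let : NormedCommRing A := NormedCommRing.induced A _ f hf
  let : NormedCommRing B := NormedCommRing.induced B _ f' hf'
  let : NormedAlgebra ℝ A := NormedAlgebra.induced ℝ A _ f
  let : NormedAlgebra ℝ B := NormedAlgebra.induced ℝ B _ f'
  exact ⟨WeilBundle.isAffineBundleByAddition n M hφ, fun hn =>
    ⟨fun h => WeilBundle.ker_sq_eq_bot_of_sub_mem n M hφ hn h.sub_mem,
      WeilBundle.isAffineBundleByAddition n M hφ⟩⟩
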